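/- Let $X$ and $V$ be finite connected networks: finite connected simple graphs (no loops) in which every edge $[x,y]$ has a positive conductance $a(x,y)=a(y,x)$. Put $m(x)=\sum_y a(x,y)$, and let $P$, $Q$ be the transition matrices with entries $a(x,y)/m(x)$ over $X$ and $V$. Assume $|X|\ge 2$; let $a\ne b$ be vertices of $V$, let $\gamma$ be a conductance-preserving bijection of $V$ with $\gamma a=b$, $\gamma b=a$, and assume that $V\setminus\{b\}$ is connected. Set $V^o=V\setminus\{a,b\}$ and let $Q_{V^o}$ be the restriction of $Q$ to $V^o$. For every edge $e$ of $X$ choose which of its endpoints is $e^a$ and which is $e^b$. The network $X[V]$ has vertex set $X\cup(E_X\times V^o)$; it is obtained from the disjoint copies $\{e\}\times V$, $e\in E_X$, by identifying $(e,a)$ with $e^a$ and $(e,b)$ with $e^b$, and the edge coming from $(e,[u,v])$ has conductance $a_X(e)\,a_V(u,v)$. Let $P_*$ be its transition matrix. All matrices act on complex-valued functions by $Pf(x)=\sum_y p(x,y)f(y)$, and $\operatorname{spec}$ denotes the spectrum. For $z\notin\operatorname{spec}(Q_{V^o})$ let $G_{V^o}(\cdot,\cdot|z)$ be the entries of $(zI-Q_{V^o})^{-1}$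 and $$\psi(z)=\sum_{u,v\in V^o}q(a,u)G_{V^o}(u,v|z)q(v,b)+q(a,b),\qquad \theta(z)=\sum_{u,v\in V^o}q(a,u)G_{V^o}(u,v|z)q(v,a).$$ Let $\varphi$ be the rational function $\varphi(z)=G(b,b|z)/G(a,b|z)$, where $G(\cdot,\cdot|z)$ are the entries of $(zI-Q)^{-1}$. Put $$\mathcal S_1=\{\lambda^*\in[-1,1]\setminus\operatorname{spec}(Q_{V^o}):\psi(\lambda^*)\neq0,\ \varphi(\lambda^*)\in\operatorname{spec}(P)\},$$ $$\mathcal S_2=\{\lambda^*\in[-1,1]\setminus\operatorname{spec}(Q_{V^o}):\psi(\lambda^*)=0,\ \theta(\lambda^*)=\lambda^*\}.$$ Let $\nu_Q(\lambda)$ and $\nu_o(\lambda)$ be the dimensions of the $\lambda$-eigenspaces of $Q$ and $Q_{V^o}$. For $f$ on $V^o$ and $w\in\{a,b\}$ write $Qf(w)=\sum_{v\in V^o}q(w,v)f(v)$. * $\lambda\in\operatorname{spec}(Q)$ has type (III) if its eigenspace has a basis $f_1,\dots,f_\nu$ with $f_j(a)=f_j(b)=0$ for $j<\nu$, $f_\nu(a)=-f_\nu(b)=1$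 and $f_\nu\circ\gamma=-f_\nu$. * $\lambda\in\operatorname{spec}(Q_{V^o})$ has type (II$^o$), resp. (III$^o$), if its eigenspace has a basis $f_1,\dots,f_\nu$ with $Qf_j(a)=Qf_j(b)=0$ for $j<\nu$, and $Qf_\nu(a)=Qf_\nu(b)=1$, $f_\nu\circ\gamma=f_\nu$, resp. $Qf_\nu(a)=-Qf_\nu(b)=1$, $f_\nu\circ\gamma=-f_\nu$. * $\lambda\in\operatorname{spec}(Q_{V^o})$ has type (IV$^o$) if its eigenspace has a basis $f_1,\dots,f_\nu$ with $Qf_j(a)=Qf_j(b)=0$ for $j<\nu-1$, $Qf_\nu(a)=Qf_{\nu-1}(b)=1$, $Qf_\nu(b)=Qf_{\nu-1}(a)=0$, $f_\nu\circ\gamma=f_{\nu-1}$ and $f_{\nu-1}\circ\gamma=f_\nu$. Then, as sets, $$\operatorname{spec}(P_*)=\bigl(\mathcal S_1\cup\mathcal S_2\cup\operatorname{spec}(Q_{V^o})\bigr)\setminus\mathsf{Exc},$$ where $\mathsf{Exc}$ is empty unless $X$ is a tree or $X$ has precisely one cycle and the length of this cycle is odd, and: (A) If $X$ is a tree and $|X|\ge3$,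 then $$\mathsf{Exc}=\{\lambda^*\in\operatorname{spec}(Q_{V^o})\setminus\operatorname{spec}(Q):\nu_o(\lambda^*)=1\text{ and }\lambda^*\text{ has type (II}^o)\text{ or (III}^o)\}.$$ If $|X|=2$ (so that $X$ is a single edge), then $\mathsf{Exc}$ is the union of this set with $$\{\lambda^*\in\operatorname{spec}(Q_{V^o})\setminus\operatorname{spec}(Q):\nu_o(\lambda^*)=2\text{ and }\lambda^*\text{ has type (IV}^o)\}.$$ (B) If $X$ has precisely one cycle and its length is odd, then $$\begin{aligned}\mathsf{Exc}=\ &\{\lambda^*\in\operatorname{spec}(Q_{V^o})\setminus\operatorname{spec}(Q):\nu_o(\lambda^*)=1\text{ and }\lambda^*\text{ has type (II}^o)\}\\ &\cup\{\lambda^*\in\operatorname{spec}(Q_{V^o})\cap\operatorname{spec}(Q):\nu_o(\lambda^*)=\nu_Q(\lambda^*)=1\text{ and }\lambda^*\text{ has types (II}^o)\text{ and (III)}\}.\end{aligned}$$ Furthermore: (C.1) If $X$ is bipartite then $\operatorname{spec}(Q)\subset\operatorname{spec}(P_*)$. (C.2) If $X$ is not bipartite then $\operatorname{spec}(Q)\setminus\{\lambda\in\operatorname{spec}(Q):\lambda\text{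 has type (III) and }\nu_Q(\lambda)=1\}\subset\operatorname{spec}(P_*)$. -/

import Mathlib

/-- A network: a loopless graph whose edges carry positive, symmetric conductances. -/
structure Network (V : Type*) where
  graph : SimpleGraph V
  cond : V → V → ℝ
  cond_symm : ∀ x y, cond x y = cond y x
  cond_pos : ∀ x y, graph.Adj x y → 0 < cond x y
  cond_zero : ∀ x y, ¬ graph.Adj x y → cond x y = 0

namespace Network

/-- Total conductance `m(x) = ∑_y a(x,y)`. -/
noncomputable def total {V : Type*} [Fintype V] (N : Network V) (x : V) : ℝ :=
  ∑ y, N.cond x y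

/-- Transition matrix `p(x,y) = a(x,y) / m(x)`, with complex entries since it acts on
complex-valued functions. -/
noncomputable def transition {V : Type*} [Fintype V] (N : Network V) : Matrix V V ℂ :=
  Matrix.of fun x y => ((N.cond x y / N.total x : ℝ) : ℂ)

/-- The edge set of the underlying graph, as a type. -/
abbrev Edge {V : Type*} (N : Network V) : Type _ := N.graph.edgeSet

noncomputable instance {V : Type*} [Finite V] (N : Network V) : Fintype N.Edge :=
  Fintype.ofFinite _

/-- A choice, for each edge `e = [x,y]`, of its initial vertex `e^a` and terminal vertex `e^b`. -/
structure Orientation {V : Type*} (N : Network V) where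
  init : N.Edge → V
  term : N.Edge → V
  mk_eq : ∀ e, s(init e, term e) = (e : Sym2 V)

/-- An automorphism of the network which exchanges `a` and `b`. -/
structure Swap {V : Type*} (N : Network V) (a b : V) where
  perm : Equiv.Perm V
  cond_map : ∀ u v, N.cond (perm u) (perm v) = N.cond u v
  map_a : perm a = b
  map_b : perm b = a

end Network

/-- `V^o = V \ {a,b}`. -/
abbrev Interior {V : Type*} (a b : V) : Type _ := {v : V // v ≠ a ∧ v ≠ b}

/-- The action on `V^o` of an automorphism which exchanges `a` and `b`. -/
def Network.Swap.onInterior {V : Type*} {N : Network V} {a b : V} (γ : N.Swap a b)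
    (v : Interior a b) : Interior a b :=
  ⟨γ.perm v.1,
    fun h => v.2.2 (γ.perm.injective (h.trans γ.map_b.symm)),
    fun h => v.2.1 (γ.perm.injective (h.trans γ.map_a.symm))⟩

section Substitution

variable {X V : Type*} [DecidableEq V]

/-- The identification map `π : E_X × V → X ∪ (E_X × V^o)`. -/
def identify {N : Network X} (o : N.Orientation) (a b : V) (e : N.Edge) (v : V) :
    X ⊕ (N.Edge × Interior a b) :=
  if ha : v = a then Sum.inl (o.init e)
  else if hb : v = b then Sum.inl (o.term e)
  else Sum.inr (e, ⟨v, ha, hb⟩)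

theorem identify_injective {N : Network X} (o : N.Orientation) (a b : V) (e : N.Edge) :
    Function.Injective (identify o a b e) := by
  have hne : o.init e ≠ o.term e := by
    have h : s(o.init e, o.term e) ∈ N.graph.edgeSet := by
      rw [o.mk_eq e]; exact e.2
    exact (N.graph.mem_edgeSet.1 h).ne
  intro u v h
  unfold identify at h
  split_ifs at h <;> simp_all

/-- The network `X[V]`. Its edges are the images under `π` of the edges of the disjoint copies
`{e} × V`, `e ∈ E_X`, and the edge coming from `(e, [u,v])` has conductance `a_X(e) a_V(u,v)`. -/
noncomputable def Network.subst [Fintype X] [Fintype V] [DecidableEq X] (N : Network X)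
    (M : Network V) (a b : V) (o : N.Orientation) :
    Network (X ⊕ (N.Edge × Interior a b)) where
  graph :=
    { Adj := fun p q => ∃ e u v, M.graph.Adj u v ∧ identify o a b e u = p ∧ identify o a b e v = q
      symm := ⟨fun _ _ ⟨e, u, v, h, hp, hq⟩ => ⟨e, v, u, h.symm, hq, hp⟩⟩
      loopless := ⟨fun _ ⟨e, _, _, h, hp, hq⟩ =>
        h.ne (identify_injective o a b e (hp.trans hq.symm))⟩ }
  cond := fun p q => ∑ e : N.Edge, ∑ u : V, ∑ v : V,
    if identify o a b e u = p ∧ identify o a b e v = q then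
      N.cond (o.init e) (o.term e) * M.cond u v else 0
  cond_symm := by
    intro p q
    refine Finset.sum_congr rfl fun e _ => ?_
    rw [Finset.sum_comm]
    refine Finset.sum_congr rfl fun u _ => Finset.sum_congr rfl fun v _ => ?_
    simp only [M.cond_symm v u, and_comm]
  cond_pos := by
    rintro p q ⟨e, u, v, h, hp, hq⟩
    have hX : ∀ e : N.Edge, 0 < N.cond (o.init e) (o.term e) := fun e =>
      N.cond_pos _ _ (N.graph.mem_edgeSet.1 (by rw [o.mk_eq e]; exact e.2))
    have hV : ∀ u v, 0 ≤ M.cond u v := fun u v => by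
      by_cases huv : M.graph.Adj u v
      · exact (M.cond_pos u v huv).le
      · exact (M.cond_zero u v huv).ge
    have h0 : ∀ (e : N.Edge) (u v : V), 0 ≤ (if identify o a b e u = p ∧ identify o a b e v = q then
        N.cond (o.init e) (o.term e) * M.cond u v else 0) := fun e u v => by
      split_ifs
      · exact mul_nonneg (hX e).le (hV u v)
      · exact le_rfl
    refine Finset.sum_pos' (fun e _ => Finset.sum_nonneg fun u _ => Finset.sum_nonneg fun v _ =>
      h0 e u v) ⟨e, Finset.mem_univ _, ?_⟩
    refine Finset.sum_pos' (fun u _ => Finset.sum_nonneg fun v _ => h0 e u v)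
      ⟨u, Finset.mem_univ _, ?_⟩
    refine Finset.sum_pos' (fun v _ => h0 e u v) ⟨v, Finset.mem_univ _, ?_⟩
    rw [if_pos ⟨hp, hq⟩]
    exact mul_pos (hX e) (M.cond_pos u v h)
  cond_zero := by
    intro p q h
    refine Finset.sum_eq_zero fun e _ => Finset.sum_eq_zero fun u _ =>
      Finset.sum_eq_zero fun v _ => ?_
    split_ifs with hpq
    · rw [M.cond_zero u v fun huv => h ⟨e, u, v, huv, hpq.1, hpq.2⟩, mul_zero]
    · rfl

end Substitution

section Spectral

variable {V : Type*} [Fintype V]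

/-- The spectrum of the operator `f ↦ (x ↦ ∑_y A(x,y) f(y))` on complex-valued functions. -/
noncomputable def spec (A : Matrix V V ℂ) : Set ℂ := spectrum ℂ A.mulVecLin

/-- The eigenspace of `A` for `z`. -/
noncomputable abbrev eigenspaceOf (A : Matrix V V ℂ) (z : ℂ) : Submodule ℂ (V → ℂ) :=
  Module.End.eigenspace A.mulVecLin z

/-- The multiplicity of `z` as an eigenvalue of `A`. -/
noncomputable def mult (A : Matrix V V ℂ) (z : ℂ) : ℕ := Module.finrank ℂ (eigenspaceOf A z)

variable [DecidableEq V]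

/-- The restriction of `A` to `V^o`. -/
def interiorPart (A : Matrix V V ℂ) (a b : V) : Matrix (Interior a b) (Interior a b) ℂ :=
  A.submatrix Subtype.val Subtype.val

/-- The Green kernel `G(u,v|z)` of `A`, whose entries are rational functions of `z`. -/
noncomputable def greenRat (A : Matrix V V ℂ) : Matrix V V (RatFunc ℂ) :=
  (Matrix.scalar V RatFunc.X - A.map RatFunc.C)⁻¹

/-- The rational function `F(u,v|z) = G(u,v|z) / G(v,v|z)`. -/
noncomputable def hitRat (A : Matrix V V ℂ) (u v : V) : RatFunc ℂ :=
  greenRat A u v / greenRat A v v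

/-- The value at `z` of the rational function `φ = 1 / F(a,b|·)` (in lowest terms). It is used only
at points which are not poles of `φ`. -/
noncomputable def phi (A : Matrix V V ℂ) (a b : V) (z : ℂ) : ℂ :=
  RatFunc.eval (RingHom.id ℂ) z (1 / hitRat A a b)

/-- The resolvent `(z I - A_{V^o})⁻¹`, for `z` outside of the spectrum of `A_{V^o}`. -/
noncomputable def interiorGreen (A : Matrix V V ℂ) (a b : V) (z : ℂ) :
    Matrix (Interior a b) (Interior a b) ℂ :=
  (Matrix.scalar (Interior a b) z - interiorPart A a b)⁻¹

/-- `ψ(z) = ∑_{u,v ∈ V^o} q(a,u) G_{V^o}(u,v|z) q(v,b) + q(a,b)`. -/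
noncomputable def psi (A : Matrix V V ℂ) (a b : V) (z : ℂ) : ℂ :=
  (∑ u : Interior a b, ∑ v : Interior a b, A a u * interiorGreen A a b z u v * A v b) + A a b

/-- `θ(z) = ∑_{u,v ∈ V^o} q(a,u) G_{V^o}(u,v|z) q(v,a)`. -/
noncomputable def theta (A : Matrix V V ℂ) (a b : V) (z : ℂ) : ℂ :=
  ∑ u : Interior a b, ∑ v : Interior a b, A a u * interiorGreen A a b z u v * A v a

/-- The real interval `[-1,1]` inside `ℂ`. -/
def realUnitInterval : Set ℂ := (fun r : ℝ => (r : ℂ)) '' Set.Icc (-1) 1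

/-- `S₁`, for the transition matrices `P` over `X` and `Q` over `V`. -/
def S1 {X : Type*} [Fintype X] (P : Matrix X X ℂ) (Q : Matrix V V ℂ) (a b : V) : Set ℂ :=
  {z | z ∈ realUnitInterval ∧ z ∉ spec (interiorPart Q a b) ∧ psi Q a b z ≠ 0 ∧
    phi Q a b z ∈ spec P}

/-- `S₂`, for the transition matrix `Q` over `V`. -/
def S2 (Q : Matrix V V ℂ) (a b : V) : Set ℂ :=
  {z | z ∈ realUnitInterval ∧ z ∉ spec (interiorPart Q a b) ∧ psi Q a b z = 0 ∧
    theta Q a b z = z}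

/-- For `f` on `V^o`, the value `Qf(w) = ∑_{v ∈ V^o} q(w,v) f(v)` at `w ∈ V`. -/
noncomputable def interiorFlux (Q : Matrix V V ℂ) {a b : V} (f : Interior a b → ℂ) (w : V) : ℂ :=
  ∑ v : Interior a b, Q w v * f v

end Spectral

section Types

variable {V : Type*} [Fintype V] (M : Network V) {a b : V} (γ : M.Swap a b)

/-- Type (III) for an eigenvalue of `Q`: the eigenspace has a basis `f₁, …, f_ν` with `f_j(a) = f_j(b) = 0`
for `j < ν`, while `f_ν(a) = -f_ν(b) = 1` and `f_ν ∘ γ = -f_ν`. -/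
def HasTypeIII (z : ℂ) : Prop :=
  ∃ (n : ℕ) (f : Module.Basis (Fin (n + 1)) ℂ (eigenspaceOf M.transition z)),
    (∀ j : Fin n, (f j.castSucc).1 a = 0 ∧ (f j.castSucc).1 b = 0) ∧
    (f (Fin.last n)).1 a = 1 ∧ (f (Fin.last n)).1 b = -1 ∧
    ∀ v, (f (Fin.last n)).1 (γ.perm v) = -(f (Fin.last n)).1 v

variable [DecidableEq V]

/-- Type (II°) for an eigenvalue of `Q_{V^o}`: the eigenspace has a basis `f₁, …, f_ν` with
`Qf_j(a) = Qf_j(b) = 0` for `j < ν`, while `Qf_ν(a) = Qf_ν(b) = 1` and `f_ν ∘ γ = f_ν`. -/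
def HasTypeIIo (z : ℂ) : Prop :=
  ∃ (n : ℕ) (f : Module.Basis (Fin (n + 1)) ℂ
      (eigenspaceOf (interiorPart M.transition a b) z)),
    (∀ j : Fin n, interiorFlux M.transition (f j.castSucc).1 a = 0 ∧
      interiorFlux M.transition (f j.castSucc).1 b = 0) ∧
    interiorFlux M.transition (f (Fin.last n)).1 a = 1 ∧
    interiorFlux M.transition (f (Fin.last n)).1 b = 1 ∧
    ∀ v, (f (Fin.last n)).1 (γ.onInterior v) = (f (Fin.last n)).1 v

/-- Type (III°) for an eigenvalue of `Q_{V^o}`: as type (II°), but with `Qf_ν(a) = -Qf_ν(b) = 1` and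
`f_ν ∘ γ = -f_ν`. -/
def HasTypeIIIo (z : ℂ) : Prop :=
  ∃ (n : ℕ) (f : Module.Basis (Fin (n + 1)) ℂ
      (eigenspaceOf (interiorPart M.transition a b) z)),
    (∀ j : Fin n, interiorFlux M.transition (f j.castSucc).1 a = 0 ∧
      interiorFlux M.transition (f j.castSucc).1 b = 0) ∧
    interiorFlux M.transition (f (Fin.last n)).1 a = 1 ∧
    interiorFlux M.transition (f (Fin.last n)).1 b = -1 ∧
    ∀ v, (f (Fin.last n)).1 (γ.onInterior v) = -(f (Fin.last n)).1 v

/-- Type (IV°) for an eigenvalue of `Q_{V^o}`: the eigenspace has a basis `f₁, …, f_ν` with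
`Qf_j(a) = Qf_j(b) = 0` for `j < ν - 1`, while `Qf_ν(a) = Qf_{ν-1}(b) = 1`,
`Qf_ν(b) = Qf_{ν-1}(a) = 0`, `f_ν ∘ γ = f_{ν-1}` and `f_{ν-1} ∘ γ = f_ν`. -/
def HasTypeIVo (z : ℂ) : Prop :=
  ∃ (n : ℕ) (f : Module.Basis (Fin (n + 2)) ℂ
      (eigenspaceOf (interiorPart M.transition a b) z)),
    (∀ j : Fin n, interiorFlux M.transition (f j.castSucc.castSucc).1 a = 0 ∧
      interiorFlux M.transition (f j.castSucc.castSucc).1 b = 0) ∧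
    interiorFlux M.transition (f (Fin.last (n + 1))).1 a = 1 ∧
    interiorFlux M.transition (f (Fin.last n).castSucc).1 b = 1 ∧
    interiorFlux M.transition (f (Fin.last (n + 1))).1 b = 0 ∧
    interiorFlux M.transition (f (Fin.last n).castSucc).1 a = 0 ∧
    (∀ v, (f (Fin.last (n + 1))).1 (γ.onInterior v) = (f (Fin.last n).castSucc).1 v) ∧
    ∀ v, (f (Fin.last n).castSucc).1 (γ.onInterior v) = (f (Fin.last (n + 1))).1 v

end Types

/-- The graph has precisely one cycle (as a subgraph), and the length of this cycle is odd. -/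
def HasUniqueCycleOdd {X : Type*} (G : SimpleGraph X) : Prop :=
  ∃ (x : X) (c : G.Walk x x), c.IsCycle ∧ Odd c.length ∧
    ∀ (y : X) (d : G.Walk y y), d.IsCycle → d.toSubgraph = c.toSubgraph

/-! A function on `X[V]` is a family of functions `g e` on `V`, one per edge of `X`, whose values at
`a` and `b` agree with a common function `s` on `X`. It is an eigenfunction for `z` exactly when
each `g e` solves the eigenvalue equation on `V^o` and the weighted sum of the values `Q(g e)(a)`,
`Q(g e)(b)` at the edge ends meeting in `x` equals `m(x) z s(x)` (`subst_mulVec_eq_smul_iff`).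

If `z` is not an eigenvalue of `Q_{V^o}`, then `g e` is determined by its two boundary values, and
the map from these values to `(Qg(a), Qg(b))` has the matrix with rows `(θ, ψ)` and `(ψ, θ)`. The
balance becomes `θ s + ψ P s = z s`. Since `φ ψ = z - θ` when `ψ ≠ 0` (`phi_mul_psi`), this is `S1 ∪
S2`.

If `z` is an eigenvalue of `Q_{V^o}`, consider the flux map `f ↦ (Qf(a), Qf(b))` on its eigenspace.
A nonzero kernel yields eigenfunctions over `X[V]` at once. Otherwise the image is a nonzero
subspace of `ℂ²` invariant under the swap: the line of `(1,1)`, the line of `(1,-1)`, or all of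
`ℂ²`, which are types II°, III° and IV° (`types_of_flux_injective`). On a line spanned by `(1,-ε)`,
eigenfunctions vanishing on `X` correspond to the kernel of a signed incidence matrix. This kernel
is trivial for trees, and for `ε = -1` on a graph with one odd cycle; rank counting shows that it is
nontrivial in the remaining cases. Type IV° leaves two free coefficients per edge against one
equation per vertex, so it can fail only on a single edge.

Eigenfunctions not vanishing on `X` remain. By Green's identity
(`InteriorEigen.boundary_orthogonal`) `s` is then multiplied by `ε` along every edge, and averaging
the copies produces an eigenfunction of `Q` (`mem_spec_of_signed_eigenfunction`). Conversely,
eigenfunctions of `Q` can be copied onto `X[V]` with signs if their symmetry or a 2-colouring of `X`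
permits (`mem_spec_subst_of_signed`). -/

/-! ### Trees, unicyclic graphs and the parity of the cycle -/

namespace SimpleGraph

variable {X : Type*} {G : SimpleGraph X}

theorem natCard_edgeSet_deleteEdges_singleton [Finite X] {e : Sym2 X} (he : e ∈ G.edgeSet) :
    Nat.card (G.deleteEdges {e}).edgeSet + 1 = Nat.card G.edgeSet := by
  have h := Set.ncard_sdiff_singleton_add_one he (Set.toFinite _)
  rw [edgeSet_deleteEdges]
  exact h

/-- A cycle edge is not a bridge, so its removal keeps the graph connected, while at most `|X| - 1`
edges remain. -/
theorem Connected.isTree_deleteEdges_of_isCycle [Finite X] (hG : G.Connected)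
    (hcard : Nat.card G.edgeSet ≤ Nat.card X) {x : X} {c : G.Walk x x} (hc : c.IsCycle)
    {e : Sym2 X} (he : e ∈ c.edges) : (G.deleteEdges {e}).IsTree := by
  have heG := c.edges_subset_edgeSet he
  have hconn : (G.deleteEdges {e}).Connected := by
    induction e with
    | _ u v =>
      exact hG.connected_delete_edge_of_not_isBridge fun h => h.notMem_edges_of_isCycle hc he
  have h1 := natCard_edgeSet_deleteEdges_singleton heG
  have h2 := hconn.card_vert_le_card_edgeSet_add_one
  exact isTree_iff_connected_and_card.2 ⟨hconn, by omega⟩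

/-- A cycle avoiding `e` would survive in the tree left after deleting `e`. -/
theorem Connected.mem_edges_of_isCycle [Finite X] (hG : G.Connected)
    (hcard : Nat.card G.edgeSet ≤ Nat.card X) {x y : X} {c : G.Walk x x} (hc : c.IsCycle)
    {d : G.Walk y y} (hd : d.IsCycle) {e : Sym2 X} (he : e ∈ c.edges) : e ∈ d.edges := by
  by_contra h
  have ht := hG.isTree_deleteEdges_of_isCycle hcard hc he
  refine ht.isAcyclic _ (hd.toDeleteEdges _ (s := {e}) ?_)
  intro e' he' hm
  exact h (Set.mem_singleton_iff.1 hm ▸ he')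

theorem Connected.toSubgraph_eq_of_isCycle [Finite X] (hG : G.Connected)
    (hcard : Nat.card G.edgeSet ≤ Nat.card X) {x y : X} {c : G.Walk x x} (hc : c.IsCycle)
    {d : G.Walk y y} (hd : d.IsCycle) : d.toSubgraph = c.toSubgraph := by
  have hmem : ∀ e, e ∈ d.edges ↔ e ∈ c.edges := fun e =>
    ⟨hG.mem_edges_of_isCycle hcard hd hc, hG.mem_edges_of_isCycle hcard hc hd⟩
  refine Subgraph.ext ?_ ?_
  · ext v
    rw [Walk.mem_verts_toSubgraph, Walk.mem_verts_toSubgraph,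
      Walk.mem_support_iff_exists_mem_edges_of_not_nil hc.not_nil,
      Walk.mem_support_iff_exists_mem_edges_of_not_nil hd.not_nil]
    simp only [hmem]
  · ext u v
    rw [← Subgraph.mem_edgeSet, ← Subgraph.mem_edgeSet, Walk.mem_edges_toSubgraph,
      Walk.mem_edges_toSubgraph, hmem]

/-- Parity of a walk when exactly one edge `e` is monochromatic. -/
theorem Walk.odd_length_of_coloring_deleteEdges [DecidableEq X] {u v a b : X} (χ : X → Bool)
    (hχ : ∀ x y, G.Adj x y → s(x, y) ≠ s(u, v) → χ x ≠ χ y) (huv : χ u = χ v) (p : G.Walk a b) :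
    Even (p.length + p.edges.count s(u, v)) ↔ χ a = χ b := by
  induction p with
  | nil => simp
  | @cons a c b h p ih =>
    rw [Walk.length_cons, Walk.edges_cons, List.count_cons]
    by_cases he : s(a, c) = s(u, v)
    · have hac : χ a = χ c := by
        rcases Sym2.eq_iff.1 he with ⟨rfl, rfl⟩ | ⟨rfl, rfl⟩
        · exact huv
        · exact huv.symm
      rw [he, hac, ← ih]
      simp only [BEq.rfl, if_true]
      grind
    · have hac := hχ a c h he
      have : (s(a, c) == s(u, v)) = false := by simpa using he
      rw [this]
      simp only [Bool.false_eq_true, if_false, add_zero]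
      rw [add_right_comm, Nat.even_add_one, ih]
      revert hac
      cases χ a <;> cases χ b <;> cases χ c <;> simp

/-- Delete a cycle edge and 2-colour the resulting tree. The ends of that edge must share a colour,
otherwise the whole graph would be bipartite. -/
theorem Connected.hasUniqueCycleOdd_of_card_le [Finite X] (hG : G.Connected)
    (hcard : Nat.card G.edgeSet ≤ Nat.card X) (hb : ¬ G.IsBipartite) : HasUniqueCycleOdd G := by
  classical
  have hac : ¬ G.IsAcyclic := fun h => hb h.isBipartite
  simp only [IsAcyclic, not_forall, not_not] at hac
  obtain ⟨x, c, hc⟩ := hac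
  refine ⟨x, c, hc, ?_, fun y d hd => hG.toSubgraph_eq_of_isCycle hcard hc hd⟩
  obtain ⟨e, he⟩ : ∃ e, e ∈ c.edges := by
    obtain ⟨e, he, -⟩ := (Walk.mem_support_iff_exists_mem_edges_of_not_nil hc.not_nil).1
      c.start_mem_support
    exact ⟨e, he⟩
  induction e with
  | _ u v =>
    obtain ⟨χ⟩ := (hG.isTree_deleteEdges_of_isCycle hcard hc he).isBipartite
    let χ' : X → Bool := fun x => χ x == 0
    have hχ : ∀ x y, G.Adj x y → s(x, y) ≠ s(u, v) → χ' x ≠ χ' y := by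
      intro x y hxy hne
      have := χ.valid (v := x) (w := y) (by simp [deleteEdges_adj, hxy, hne])
      simp only [χ']
      generalize χ x = i at *
      generalize χ y = j at *
      fin_cases i <;> fin_cases j <;> simp_all
    have huv : χ' u = χ' v := by
      by_contra huv
      refine hb ?_
      have : G.Coloring Bool := Coloring.mk χ' (by
        intro x y hxy
        by_cases hne : s(x, y) = s(u, v)
        · rcases Sym2.eq_iff.1 hne with ⟨rfl, rfl⟩ | ⟨rfl, rfl⟩
          · exact huv
          · exact Ne.symm huv
        · exact hχ x y hxy hne)
      simpa using this.colorable
    have h := (Walk.odd_length_of_coloring_deleteEdges χ' hχ huv c).2 rfl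
    -- The cycle uses the monochromatic edge exactly once, so its length plus one is even.
    rw [List.count_eq_one_of_mem hc.edges_nodup he] at h
    grind

end SimpleGraph

theorem HasUniqueCycleOdd.not_isBipartite {X : Type*} {G : SimpleGraph X}
    (h : HasUniqueCycleOdd G) : ¬ G.IsBipartite := by
  obtain ⟨x, c, -, hodd, -⟩ := h
  intro hb
  have := SimpleGraph.two_colorable_iff_forall_loop_even.1 hb x c
  exact Nat.not_even_iff_odd.2 hodd this

/-- Deleting an edge of the only cycle leaves a connected acyclic graph, that is, a tree. -/
theorem HasUniqueCycleOdd.card_edgeSet {X : Type*} [Finite X] {G : SimpleGraph X}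
    (hG : G.Connected) (h : HasUniqueCycleOdd G) : Nat.card G.edgeSet = Nat.card X := by
  obtain ⟨x, c, hc, -, huniq⟩ := h
  obtain ⟨e, he, -⟩ := (SimpleGraph.Walk.mem_support_iff_exists_mem_edges_of_not_nil hc.not_nil).1
    c.start_mem_support
  have hconn : (G.deleteEdges {e}).Connected := by
    induction e with
    | _ u v =>
      exact hG.connected_delete_edge_of_not_isBridge fun h => h.notMem_edges_of_isCycle hc he
  have hac : (G.deleteEdges {e}).IsAcyclic := by
    intro y d hd
    have hle := G.deleteEdges_le {e}
    have h1 := huniq y (d.mapLe hle) (hd.mapLe hle)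
    have h2 : e ∈ (d.mapLe hle).edges := by
      rw [← SimpleGraph.Walk.mem_edges_toSubgraph, h1, SimpleGraph.Walk.mem_edges_toSubgraph]
      exact he
    rw [SimpleGraph.Walk.edges_mapLe_eq_edges] at h2
    have := d.edges_subset_edgeSet h2
    simp [SimpleGraph.edgeSet_deleteEdges] at this
  have h1 := SimpleGraph.natCard_edgeSet_deleteEdges_singleton (c.edges_subset_edgeSet he)
  have h2 := (SimpleGraph.isTree_iff_connected_and_card.1 ⟨hconn, hac⟩).2
  omega

/-! ### Eigenvalues of matrices and spectra of reversible networks -/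

section Eigen

variable {V : Type*} [Fintype V]

theorem mem_spec_iff {A : Matrix V V ℂ} {z : ℂ} :
    z ∈ spec A ↔ ∃ f : V → ℂ, f ≠ 0 ∧ A.mulVec f = z • f := by
  rw [spec, ← Module.End.hasEigenvalue_iff_mem_spectrum]
  constructor
  · intro h
    obtain ⟨f, hf⟩ := h.exists_hasEigenvector
    exact ⟨f, hf.2, by simpa using hf.apply_eq_smul⟩
  · rintro ⟨f, hf, h⟩
    exact Module.End.hasEigenvalue_of_hasEigenvector
      ⟨Module.End.mem_eigenspace_iff.2 (by simpa using h), hf⟩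

theorem mem_eigenspaceOf_iff {A : Matrix V V ℂ} {z : ℂ} {f : V → ℂ} :
    f ∈ eigenspaceOf A z ↔ A.mulVec f = z • f := by
  rw [Module.End.mem_eigenspace_iff, Matrix.mulVecLin_apply]

end Eigen

namespace Network

theorem cond_nonneg {V : Type*} (N : Network V) (x y : V) : 0 ≤ N.cond x y := by
  by_cases h : N.graph.Adj x y
  · exact (N.cond_pos x y h).le
  · exact (N.cond_zero x y h).ge

variable {V : Type*} [Fintype V] {N : Network V}

theorem total_pos [Nontrivial V] (hN : N.graph.Connected) (x : V) : 0 < N.total x := by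
  obtain ⟨y, hy⟩ := hN.preconnected.exists_adj_of_nontrivial x
  exact Finset.sum_pos' (fun y _ => N.cond_nonneg x y) ⟨y, Finset.mem_univ _, N.cond_pos x y hy⟩

theorem total_mul_transition {x : V} (hx : N.total x ≠ 0) (y : V) :
    (N.total x : ℂ) * N.transition x y = N.cond x y := by
  rw [transition, Matrix.of_apply, ← Complex.ofReal_mul, mul_div_cancel₀ _ hx]

theorem total_mul_transition_mulVec {x : V} (hx : N.total x ≠ 0) (f : V → ℂ) :
    (N.total x : ℂ) * N.transition.mulVec f x = ∑ y, (N.cond x y : ℂ) * f y := by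
  rw [Matrix.mulVec, dotProduct, Finset.mul_sum]
  exact Finset.sum_congr rfl fun y _ => by rw [← mul_assoc, total_mul_transition hx]

theorem transition_self (x : V) : N.transition x x = 0 := by
  simp [transition, N.cond_zero x x (N.graph.loopless.irrefl x)]

/-- Green's identity. -/
theorem sum_total_mul_transition_mulVec_comm (hN : ∀ x, N.total x ≠ 0) (f g : V → ℂ) :
    ∑ x, (N.total x : ℂ) * (g x * N.transition.mulVec f x) =
      ∑ x, (N.total x : ℂ) * (f x * N.transition.mulVec g x) := by
  have key : ∀ f g : V → ℂ, ∑ x, (N.total x : ℂ) * (g x * N.transition.mulVec f x) =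
      ∑ x, ∑ y, (N.cond x y : ℂ) * (g x * f y) := fun f g => by
    refine Finset.sum_congr rfl fun x _ => ?_
    rw [mul_left_comm, total_mul_transition_mulVec (hN x), Finset.mul_sum]
    exact Finset.sum_congr rfl fun y _ => by ring
  rw [key, key, Finset.sum_comm]
  refine Finset.sum_congr rfl fun x _ => Finset.sum_congr rfl fun y _ => ?_
  rw [N.cond_symm]
  ring

/-- A reversible transition matrix has its spectrum in `[-1,1]`. -/
theorem spec_transition_subset (hN : ∀ x, 0 < N.total x) :
    spec N.transition ⊆ realUnitInterval := by
  intro z hz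
  obtain ⟨f, hf, hfz⟩ := mem_spec_iff.1 hz
  have hN' : ∀ x, N.total x ≠ 0 := fun x => (hN x).ne'
  set D : ℝ := ∑ x, N.total x * ‖f x‖ ^ 2 with hD
  have hDpos : 0 < D := by
    obtain ⟨x, hx⟩ := Function.ne_iff.1 hf
    refine Finset.sum_pos' (fun x _ => by have := hN x; positivity) ⟨x, Finset.mem_univ _, ?_⟩
    have := hN x
    have : 0 < ‖f x‖ := norm_pos_iff.2 hx
    positivity
  have hnorm : ∀ x, (starRingEnd ℂ) (f x) * f x = ((‖f x‖ ^ 2 : ℝ) : ℂ) := fun x => by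
    rw [mul_comm, Complex.mul_conj, Complex.normSq_eq_norm_sq]
  have h1 : z * D = ∑ x, (N.total x : ℂ) *
      ((starRingEnd ℂ) (f x) * N.transition.mulVec f x) := by
    rw [hfz, hD, Complex.ofReal_sum, Finset.mul_sum]
    refine Finset.sum_congr rfl fun x _ => ?_
    rw [Complex.ofReal_mul, ← hnorm, Pi.smul_apply, smul_eq_mul]
    ring
  have hsum : z * D = ∑ x, ∑ y, (N.cond x y : ℂ) * ((starRingEnd ℂ) (f x) * f y) := by
    rw [h1]
    refine Finset.sum_congr rfl fun x _ => ?_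
    rw [mul_left_comm, total_mul_transition_mulVec (hN' x), Finset.mul_sum]
    exact Finset.sum_congr rfl fun y _ => by ring
  -- Here `z * D` is the Hermitian form `⟨f, Pf⟩` weighted by `m`. It is real by symmetry of the
  -- conductances, and at most `D` in modulus because `2xy ≤ x² + y²`.
  have hconj : (starRingEnd ℂ) (z * D) = z * D := by
    rw [hsum, map_sum, Finset.sum_comm]
    simp only [map_sum, map_mul, Complex.conj_conj, Complex.conj_ofReal]
    rw [Finset.sum_comm]
    rw [Finset.sum_comm]
    refine Finset.sum_congr rfl fun x _ => Finset.sum_congr rfl fun y _ => ?_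
    rw [N.cond_symm]
    ring
  have hzreal : (z.re : ℂ) = z := by
    rw [← Complex.conj_eq_iff_re]
    rw [map_mul, Complex.conj_ofReal] at hconj
    exact mul_right_cancel₀ (by exact_mod_cast hDpos.ne') hconj
  have hcomm : ∑ x, ∑ y, N.cond x y * ‖f y‖ ^ 2 = D := by
    rw [Finset.sum_comm]
    refine Finset.sum_congr rfl fun x _ => ?_
    rw [total, Finset.sum_mul]
    exact Finset.sum_congr rfl fun y _ => by rw [N.cond_symm]
  have hcomm' : ∑ x, ∑ y, N.cond x y * ‖f x‖ ^ 2 = D :=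
    Finset.sum_congr rfl fun x _ => by rw [total, Finset.sum_mul]
  have hle : ‖z‖ * D ≤ D := by
    calc ‖z‖ * D = ‖z * D‖ := by rw [norm_mul, Complex.norm_of_nonneg hDpos.le]
      _ ≤ ∑ x, ∑ y, N.cond x y * (‖f x‖ * ‖f y‖) := by
        rw [hsum]
        refine (norm_sum_le _ _).trans (Finset.sum_le_sum fun x _ =>
          (norm_sum_le _ _).trans (Finset.sum_le_sum fun y _ => ?_))
        rw [norm_mul, norm_mul, Complex.norm_of_nonneg (N.cond_nonneg x y), RCLike.norm_conj]
      _ ≤ ∑ x, ∑ y, (N.cond x y * ‖f x‖ ^ 2 + N.cond x y * ‖f y‖ ^ 2) / 2 := by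
        refine Finset.sum_le_sum fun x _ => Finset.sum_le_sum fun y _ => ?_
        nlinarith [mul_nonneg (N.cond_nonneg x y) (sq_nonneg (‖f x‖ - ‖f y‖))]
      _ = D := by
        simp only [← Finset.sum_div, Finset.sum_add_distrib]
        rw [hcomm, hcomm']
        ring
  have hz1 : ‖z‖ ≤ 1 := by
    by_contra h
    nlinarith
  exact ⟨z.re, abs_le.1 ((Complex.abs_re_le_norm z).trans hz1), hzreal⟩

namespace Swap

variable {a b : V}

theorem total_perm (γ : N.Swap a b) (v : V) : N.total (γ.perm v) = N.total v := by
  rw [total, ← Equiv.sum_comp γ.perm]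
  exact Finset.sum_congr rfl fun y _ => γ.cond_map v y

theorem transition_perm (γ : N.Swap a b) (u v : V) :
    N.transition (γ.perm u) (γ.perm v) = N.transition u v := by
  simp [transition, γ.cond_map, γ.total_perm]

theorem mulVec_comp (γ : N.Swap a b) (f : V → ℂ) (v : V) :
    N.transition.mulVec (fun u => f (γ.perm u)) v = N.transition.mulVec f (γ.perm v) := by
  simp only [Matrix.mulVec, dotProduct]
  rw [← Equiv.sum_comp γ.perm fun u => N.transition (γ.perm v) u * f u]
  exact Finset.sum_congr rfl fun u _ => by rw [γ.transition_perm]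

theorem total_eq (γ : N.Swap a b) : N.total b = N.total a := by rw [← γ.map_a, γ.total_perm]

end Swap

end Network

/-! ### Functions on `V` solving the eigenvalue equation on `V^o` -/

section InteriorEigen

variable {V : Type*} [Fintype V] {a b : V}

/-- `g` satisfies the eigenvalue equation at all interior vertices. -/
def InteriorEigen (Q : Matrix V V ℂ) (a b : V) (z : ℂ) (g : V → ℂ) : Prop :=
  ∀ v : Interior a b, Q.mulVec g v = z * g v

theorem InteriorEigen.sum {ι : Type*} {Q : Matrix V V ℂ} {z : ℂ} (s : Finset ι) (c : ι → ℂ)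
    {g : ι → V → ℂ} (hg : ∀ i ∈ s, InteriorEigen Q a b z (g i)) :
    InteriorEigen Q a b z (∑ i ∈ s, c i • g i) := by
  intro v
  rw [Matrix.mulVec_sum, Finset.sum_apply, Finset.sum_apply, Finset.mul_sum]
  refine Finset.sum_congr rfl fun i hi => ?_
  rw [Matrix.mulVec_smul, Pi.smul_apply, Pi.smul_apply, hg i hi v, smul_eq_mul, smul_eq_mul]
  ring

theorem InteriorEigen.add_smul {Q : Matrix V V ℂ} {z : ℂ} {g h : V → ℂ} (c : ℂ)
    (hg : InteriorEigen Q a b z g) (hh : InteriorEigen Q a b z h) :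
    InteriorEigen Q a b z (g + c • h) := by
  intro v
  rw [Matrix.mulVec_add, Matrix.mulVec_smul]
  simp only [Pi.add_apply, Pi.smul_apply, smul_eq_mul]
  rw [hg v, hh v]
  ring

theorem InteriorEigen.comp_swap {M : Network V} {z : ℂ} {g : V → ℂ} (γ : M.Swap a b)
    (hg : InteriorEigen M.transition a b z g) :
    InteriorEigen M.transition a b z (fun v => g (γ.perm v)) := by
  intro v
  rw [γ.mulVec_comp]
  exact hg (γ.onInterior v)

end InteriorEigen

section Interior

variable {V : Type*} [DecidableEq V] {a b : V}

/-- The function on `V` with given values at `a`, `b` and on the interior. -/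
def glue (a b : V) (α β : ℂ) (f : Interior a b → ℂ) (v : V) : ℂ :=
  if ha : v = a then α else if hb : v = b then β else f ⟨v, ha, hb⟩

@[simp] theorem glue_left (α β : ℂ) (f : Interior a b → ℂ) : glue a b α β f a = α := by
  simp [glue]

theorem glue_right (hab : a ≠ b) (α β : ℂ) (f : Interior a b → ℂ) : glue a b α β f b = β := by
  simp [glue, hab.symm]

@[simp] theorem glue_interior (α β : ℂ) (f : Interior a b → ℂ) (v : Interior a b) :
    glue a b α β f v = f v := by
  simp [glue, v.2.1, v.2.2]

theorem glue_self (g : V → ℂ) : glue a b (g a) (g b) (fun v => g v) = g := by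
  funext v
  unfold glue
  split_ifs with h1 h2
  · rw [h1]
  · rw [h2]
  · rfl

variable [Fintype V]

theorem sum_eq_interior (hab : a ≠ b) (F : V → ℂ) :
    ∑ v, F v = F a + F b + ∑ v : Interior a b, F v := by
  rw [← Finset.add_sum_erase _ _ (Finset.mem_univ a),
    ← Finset.add_sum_erase _ _ (Finset.mem_erase.2 ⟨hab.symm, Finset.mem_univ b⟩), ← add_assoc]
  congr 1
  refine Finset.sum_subtype _ (fun v => ?_) F
  simp [and_comm]

theorem mulVec_eq_interiorFlux (hab : a ≠ b) (Q : Matrix V V ℂ) (g : V → ℂ) (w : V) :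
    Q.mulVec g w = Q w a * g a + Q w b * g b +
      interiorFlux Q (fun v : Interior a b => g v) w := by
  rw [Matrix.mulVec, dotProduct, sum_eq_interior hab, interiorFlux]

theorem interiorPart_mulVec (Q : Matrix V V ℂ) (f : Interior a b → ℂ) (v : Interior a b) :
    (interiorPart Q a b).mulVec f v = interiorFlux Q f v := rfl

theorem interiorFlux_eq_mulVec_glue (hab : a ≠ b) (Q : Matrix V V ℂ) (f : Interior a b → ℂ)
    (w : V) : interiorFlux Q f w = Q.mulVec (glue a b 0 0 f) w := by
  rw [mulVec_eq_interiorFlux hab, glue_right hab]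
  simp

theorem mem_eigenspaceOf_interiorPart (hab : a ≠ b) {Q : Matrix V V ℂ} {z : ℂ}
    {f : Interior a b → ℂ} :
    f ∈ eigenspaceOf (interiorPart Q a b) z ↔ InteriorEigen Q a b z (glue a b 0 0 f) := by
  rw [mem_eigenspaceOf_iff, funext_iff]
  refine forall_congr' fun v => ?_
  rw [interiorPart_mulVec, interiorFlux_eq_mulVec_glue hab, glue_interior, Pi.smul_apply,
    smul_eq_mul]

theorem mulVec_eq_smul_iff {Q : Matrix V V ℂ} {z : ℂ} {g : V → ℂ} :
    Q.mulVec g = z • g ↔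
      InteriorEigen Q a b z g ∧ Q.mulVec g a = z * g a ∧ Q.mulVec g b = z * g b := by
  constructor
  · intro h
    have h' : ∀ v, Q.mulVec g v = z * g v := fun v => by rw [h]; rfl
    exact ⟨fun v => h' v, h' a, h' b⟩
  · rintro ⟨h, ha, hb⟩
    funext v
    rw [Pi.smul_apply, smul_eq_mul]
    by_cases hva : v = a
    · rw [hva, ha]
    by_cases hvb : v = b
    · rw [hvb, hb]
    exact h ⟨v, hva, hvb⟩

theorem InteriorEigen.restrict_mem (hab : a ≠ b) {Q : Matrix V V ℂ} {z : ℂ} {g : V → ℂ}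
    (hg : InteriorEigen Q a b z g) (ha : g a = 0) (hb : g b = 0) :
    (fun v : Interior a b => g v) ∈ eigenspaceOf (interiorPart Q a b) z := by
  rw [mem_eigenspaceOf_interiorPart hab]
  have := glue_self (a := a) (b := b) g
  rw [ha, hb] at this
  rwa [this]

theorem interiorFlux_restrict (hab : a ≠ b) (Q : Matrix V V ℂ) {g : V → ℂ}
    (ha : g a = 0) (hb : g b = 0) (w : V) :
    interiorFlux Q (fun v : Interior a b => g v) w = Q.mulVec g w := by
  rw [mulVec_eq_interiorFlux hab, ha, hb]
  simp

/-- Interior eigenfunctions are orthogonal on the boundary to the fluxes of those which vanish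
on the boundary. -/
theorem InteriorEigen.boundary_orthogonal (hab : a ≠ b) {M : Network V}
    (hM : ∀ x, M.total x ≠ 0) (γ : M.Swap a b) {z : ℂ} {g : V → ℂ} {f : Interior a b → ℂ}
    (hg : InteriorEigen M.transition a b z g)
    (hf : f ∈ eigenspaceOf (interiorPart M.transition a b) z) :
    g a * interiorFlux M.transition f a + g b * interiorFlux M.transition f b = 0 := by
  have hf' := (mem_eigenspaceOf_interiorPart hab).1 hf
  have h := Network.sum_total_mul_transition_mulVec_comm hM g (glue a b 0 0 f)
  rw [sum_eq_interior hab, sum_eq_interior hab, glue_right hab, glue_left,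
    ← interiorFlux_eq_mulVec_glue hab, ← interiorFlux_eq_mulVec_glue hab, γ.total_eq] at h
  -- Both functions satisfy the same equation on `V^o`, so the interior terms of Green's identity
  -- cancel. Only the terms at `a` and `b` remain, with the common factor `m(a) = m(b)`.
  have h2 : ∑ v : Interior a b, (M.total v : ℂ) *
      (glue a b 0 0 f v * M.transition.mulVec g v) = ∑ v : Interior a b, (M.total v : ℂ) *
      (g v * M.transition.mulVec (glue a b 0 0 f) v) :=
    Finset.sum_congr rfl fun v _ => by rw [hg v, hf' v]; ring
  rw [h2] at h
  have h3 : (M.total a : ℂ) * (g a * interiorFlux M.transition f a +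
      g b * interiorFlux M.transition f b) = 0 := by linear_combination -h
  exact (mul_eq_zero.1 h3).resolve_left (by exact_mod_cast hM a)

end Interior

/-! ### Weighted sums over the edge ends at a vertex of `X` -/

section Incidence

variable {X : Type*} {N : Network X} (o : N.Orientation)

namespace Network.Orientation

/-- The conductance of an edge. -/
def weight (e : N.Edge) : ℝ := N.cond (o.init e) (o.term e)

theorem adj (e : N.Edge) : N.graph.Adj (o.init e) (o.term e) :=
  N.graph.mem_edgeSet.1 (by rw [o.mk_eq e]; exact e.2)

theorem weight_pos (e : N.Edge) : 0 < o.weight e := N.cond_pos _ _ (o.adj e)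

theorem weight_ne_zero (e : N.Edge) : (o.weight e : ℂ) ≠ 0 := by
  exact_mod_cast (o.weight_pos e).ne'

theorem init_ne_term (e : N.Edge) : o.init e ≠ o.term e := (o.adj e).ne

theorem exists_edge {x y : X} (h : N.graph.Adj x y) :
    ∃ e : N.Edge, (o.init e = x ∧ o.term e = y) ∨ (o.init e = y ∧ o.term e = x) :=
  ⟨⟨s(x, y), h⟩, Sym2.eq_iff.1 (o.mk_eq ⟨s(x, y), h⟩)⟩

variable [DecidableEq X] [Fintype X]

/-- The weighted sum over the edges at `x` of a function of edges with chosen endpoint, given by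
`α` at initial and by `β` at terminal vertices. -/
noncomputable def boundarySum (α β : N.Edge → ℂ) (x : X) : ℂ :=
  ∑ e, o.weight e * ((if o.init e = x then α e else 0) + (if o.term e = x then β e else 0))

/-- Each neighbour of `x` is the opposite end of exactly one edge at `x`. This is how the operator
`P` of `X` emerges from the balance equation. -/
theorem boundarySum_neighbors (F : X → ℂ) (x : X) :
    o.boundarySum (fun e => F (o.term e)) (fun e => F (o.init e)) x =
      ∑ y, (N.cond x y : ℂ) * F y := by
  have h1 : ∀ y, (N.cond x y : ℂ) * F y =
      ∑ e : N.Edge, if (e : Sym2 X) = s(x, y) then (N.cond x y : ℂ) * F y else 0 := by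
    intro y
    by_cases h : N.graph.Adj x y
    · rw [Finset.sum_eq_single (⟨s(x, y), h⟩ : N.Edge)]
      · rw [if_pos rfl]
      · intro e _ he
        exact if_neg fun h' => he (Subtype.ext h')
      · exact fun h' => absurd (Finset.mem_univ _) h'
    · simp [N.cond_zero x y h]
  rw [Finset.sum_congr rfl fun y _ => h1 y, Finset.sum_comm, boundarySum]
  refine Finset.sum_congr rfl fun e _ => ?_
  rw [← o.mk_eq e]
  have hne := o.init_ne_term e
  by_cases hi : o.init e = x
  · have ht : o.term e ≠ x := fun h => hne (hi.trans h.symm)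
    rw [if_pos hi, if_neg ht, add_zero, Finset.sum_eq_single (o.term e)]
    · rw [hi, if_pos rfl, weight, hi]
    · intro y _ hy
      refine if_neg fun h => ?_
      rcases Sym2.eq_iff.1 h with ⟨-, h⟩ | ⟨-, h⟩
      · exact hy h.symm
      · exact ht h
    · exact fun h' => absurd (Finset.mem_univ _) h'
  · rw [if_neg hi, zero_add]
    by_cases ht : o.term e = x
    · rw [if_pos ht, Finset.sum_eq_single (o.init e)]
      · rw [ht, if_pos Sym2.eq_swap, weight, ht, N.cond_symm]
      · intro y _ hy
        refine if_neg fun h => ?_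
        rcases Sym2.eq_iff.1 h with ⟨h, -⟩ | ⟨h, -⟩
        · exact hi h
        · exact hy h.symm
      · exact fun h' => absurd (Finset.mem_univ _) h'
    · rw [if_neg ht, mul_zero]
      refine (Finset.sum_eq_zero fun y _ => if_neg fun h => ?_).symm
      rcases Sym2.eq_iff.1 h with ⟨h, -⟩ | ⟨-, h⟩
      · exact hi h
      · exact ht h

theorem boundarySum_one (x : X) : o.boundarySum (fun _ => 1) (fun _ => 1) x = N.total x := by
  have := o.boundarySum_neighbors (fun _ => 1) x
  rw [this, Network.total, Complex.ofReal_sum]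
  simp

theorem boundarySum_add (α β α' β' : N.Edge → ℂ) (x : X) :
    o.boundarySum α β x + o.boundarySum α' β' x = o.boundarySum (α + α') (β + β') x := by
  rw [boundarySum, boundarySum, boundarySum, ← Finset.sum_add_distrib]
  refine Finset.sum_congr rfl fun e _ => ?_
  simp only [Pi.add_apply]
  split_ifs <;> ring

theorem mul_boundarySum (c : ℂ) (α β : N.Edge → ℂ) (x : X) :
    c * o.boundarySum α β x = o.boundarySum (fun e => c * α e) (fun e => c * β e) x := by
  rw [boundarySum, boundarySum, Finset.mul_sum]
  refine Finset.sum_congr rfl fun e _ => ?_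
  split_ifs <;> ring

/-- The boundary sum only sees the values of edge functions at their own end points. -/
theorem boundarySum_mul_endpoint (F : X → ℂ) (α β : N.Edge → ℂ) (x : X) :
    o.boundarySum (fun e => F (o.init e) * α e) (fun e => F (o.term e) * β e) x =
      F x * o.boundarySum α β x := by
  rw [boundarySum, boundarySum, Finset.mul_sum]
  refine Finset.sum_congr rfl fun e _ => ?_
  split_ifs with h1 h2 h2
  · rw [h1, h2]; ring
  · rw [h1]; ring
  · rw [h2]; ring
  · ring

/-- Summation by parts: it moves a test function on `X` to the ends of the edges. -/
theorem sum_mul_boundarySum (F : X → ℂ) (α β : N.Edge → ℂ) :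
    ∑ x, F x * o.boundarySum α β x =
      ∑ e, o.weight e * (F (o.init e) * α e + F (o.term e) * β e) := by
  simp only [← boundarySum_mul_endpoint]
  simp only [boundarySum]
  rw [Finset.sum_comm]
  refine Finset.sum_congr rfl fun e _ => ?_
  rw [← Finset.mul_sum, Finset.sum_add_distrib, Finset.sum_ite_eq, Finset.sum_ite_eq,
    if_pos (Finset.mem_univ _), if_pos (Finset.mem_univ _)]

end Network.Orientation

end Incidence

/-! ### The eigenvalue equation over `X[V]` -/

section Identify

variable {X V : Type*} [DecidableEq V] {N : Network X} (o : N.Orientation) {a b : V}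

@[simp] theorem identify_left (e : N.Edge) : identify o a b e a = Sum.inl (o.init e) := by
  simp [identify]

theorem identify_right (hab : a ≠ b) (e : N.Edge) :
    identify o a b e b = Sum.inl (o.term e) := by
  simp [identify, hab.symm]

@[simp] theorem identify_interior (e : N.Edge) (v : Interior a b) :
    identify o a b e v = Sum.inr (e, v) := by
  simp [identify, v.2.1, v.2.2]

/-- Functions on the copies of `V` which fit together on `X`. -/
theorem exists_comp_identify_eq (hab : a ≠ b) (s : X → ℂ) (g : N.Edge → V → ℂ)
    (ha : ∀ e, g e a = s (o.init e)) (hb : ∀ e, g e b = s (o.term e)) :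
    ∃ f : X ⊕ (N.Edge × Interior a b) → ℂ, (∀ x, f (Sum.inl x) = s x) ∧
      ∀ e v, f (identify o a b e v) = g e v := by
  refine ⟨Sum.elim s fun p => g p.1 p.2, fun x => rfl, fun e v => ?_⟩
  by_cases hva : v = a
  · subst hva; simp [ha]
  by_cases hvb : v = b
  · subst hvb; simp [identify_right o hab, hb]
  · rw [show v = ((⟨v, hva, hvb⟩ : Interior a b) : V) from rfl, identify_interior]
    rfl

theorem eq_zero_of_comp_identify_eq_zero {f : X ⊕ (N.Edge × Interior a b) → ℂ}
    (h1 : ∀ x, f (Sum.inl x) = 0) (h2 : ∀ e v, f (identify o a b e v) = 0) : f = 0 := by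
  funext p
  rcases p with x | ⟨e, v⟩
  · exact h1 x
  · rw [← identify_interior o e v, h2]; rfl

variable [Fintype X] [Fintype V] [DecidableEq X]

theorem sum_identify_eq_inl (hab : a ≠ b) (H : N.Edge → V → ℂ) (x : X) :
    ∑ e, ∑ u, (if identify o a b e u = Sum.inl x then (o.weight e : ℂ) * H e u else 0) =
      o.boundarySum (fun e => H e a) (fun e => H e b) x := by
  refine Finset.sum_congr rfl fun e _ => ?_
  rw [sum_eq_interior hab, identify_left, identify_right o hab]
  simp only [Sum.inl.injEq, identify_interior, reduceCtorEq, if_false, Finset.sum_const_zero,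
    add_zero]
  split_ifs <;> ring

/-- An interior vertex has only one preimage under the identification, in contrast to the points of
`X`. -/
theorem sum_identify_eq_inr (hab : a ≠ b) (H : N.Edge → V → ℂ) (e : N.Edge)
    (v : Interior a b) :
    ∑ e', ∑ u, (if identify o a b e' u = Sum.inr (e, v) then (o.weight e' : ℂ) * H e' u else 0) =
      o.weight e * H e v := by
  rw [Finset.sum_eq_single e]
  · rw [sum_eq_interior hab, identify_left, identify_right o hab]
    simp
  · intro e' _ he
    rw [sum_eq_interior hab, identify_left, identify_right o hab]
    simp [he]
  · exact fun h' => absurd (Finset.mem_univ _) h'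

variable (M : Network V)

theorem sum_subst_cond_mul (F : X ⊕ (N.Edge × Interior a b) → ℂ)
    (p : X ⊕ (N.Edge × Interior a b)) :
    ∑ q, ((N.subst M a b o).cond p q : ℂ) * F q =
      ∑ e, ∑ u, (if identify o a b e u = p then
        (o.weight e : ℂ) * ∑ v, (M.cond u v : ℂ) * F (identify o a b e v) else 0) := by
  have h : ∀ q, ((N.subst M a b o).cond p q : ℂ) * F q = ∑ e, ∑ u, ∑ v,
      if identify o a b e v = q then (if identify o a b e u = p then
        (o.weight e : ℂ) * ((M.cond u v : ℂ) * F (identify o a b e v)) else 0) else 0 := by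
    intro q
    simp only [Network.subst, Complex.ofReal_sum, Finset.sum_mul]
    refine Finset.sum_congr rfl fun e _ => Finset.sum_congr rfl fun u _ =>
      Finset.sum_congr rfl fun v _ => ?_
    by_cases h1 : identify o a b e u = p <;> by_cases h2 : identify o a b e v = q
    · simp only [h1, h2, and_self, if_true, Complex.ofReal_mul]
      rw [Network.Orientation.weight]
      ring
    all_goals simp [h1, h2]
  rw [Finset.sum_congr rfl fun q _ => h q, Finset.sum_comm]
  refine Finset.sum_congr rfl fun e _ => ?_
  rw [Finset.sum_comm]
  refine Finset.sum_congr rfl fun u _ => ?_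
  rw [Finset.sum_comm]
  simp only [Finset.sum_ite_eq, Finset.mem_univ, if_true]
  split_ifs
  · rw [Finset.mul_sum]
  · simp

theorem ofReal_subst_total (p : X ⊕ (N.Edge × Interior a b)) :
    ((N.subst M a b o).total p : ℂ) =
      ∑ e, ∑ u, (if identify o a b e u = p then (o.weight e : ℂ) * M.total u else 0) := by
  have := sum_subst_cond_mul o M (fun _ => 1) p
  simp only [mul_one] at this
  rw [Network.total, Complex.ofReal_sum, this]
  simp only [Network.total, Complex.ofReal_sum]

variable {M}

/-- The swap gives `m(a) = m(b)`, so initial and terminal ends contribute equally. The factor `m(a)`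
later cancels from the balance equation. -/
theorem subst_total_inl (hab : a ≠ b) (γ : M.Swap a b) (x : X) :
    ((N.subst M a b o).total (Sum.inl x) : ℂ) = M.total a * N.total x := by
  rw [ofReal_subst_total, sum_identify_eq_inl o hab (fun _ u => (M.total u : ℂ)), γ.total_eq,
    ← o.boundarySum_one, o.mul_boundarySum]
  simp

theorem subst_total_inr (hab : a ≠ b) (e : N.Edge) (v : Interior a b) :
    ((N.subst M a b o).total (Sum.inr (e, v)) : ℂ) = o.weight e * M.total v := by
  rw [ofReal_subst_total, sum_identify_eq_inr o hab (fun _ u => (M.total u : ℂ))]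

theorem subst_total_pos (hab : a ≠ b) (γ : M.Swap a b) (hN : ∀ x, 0 < N.total x)
    (hM : ∀ v, 0 < M.total v) (p : X ⊕ (N.Edge × Interior a b)) :
    0 < (N.subst M a b o).total p := by
  rcases p with x | ⟨e, v⟩
  · have h : (N.subst M a b o).total (Sum.inl x) = M.total a * N.total x := by
      exact_mod_cast subst_total_inl o hab γ x
    rw [h]
    exact mul_pos (hM a) (hN x)
  · have h : (N.subst M a b o).total (Sum.inr (e, v)) = o.weight e * M.total v := by
      exact_mod_cast subst_total_inr o hab e v
    rw [h]
    exact mul_pos (o.weight_pos e) (hM v)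

/-- The eigenvalue equation over `X[V]`, in terms of the restrictions to the copies of `V`. -/
theorem subst_mulVec_eq_smul_iff (hab : a ≠ b) (γ : M.Swap a b) (hN : ∀ x, 0 < N.total x)
    (hM : ∀ v, 0 < M.total v) (f : X ⊕ (N.Edge × Interior a b) → ℂ) (z : ℂ) :
    (N.subst M a b o).transition.mulVec f = z • f ↔
      (∀ e, InteriorEigen M.transition a b z fun v => f (identify o a b e v)) ∧
      ∀ x, o.boundarySum
        (fun e => M.transition.mulVec (fun v => f (identify o a b e v)) a)
        (fun e => M.transition.mulVec (fun v => f (identify o a b e v)) b) x =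
          N.total x * (z * f (Sum.inl x)) := by
  have hpos := subst_total_pos o hab γ hN hM
  have hpC : ∀ p, ((N.subst M a b o).total p : ℂ) ≠ 0 := fun p => by
    exact_mod_cast (hpos p).ne'
  have hMC : ∀ v, (M.total v : ℂ) ≠ 0 := fun v => by exact_mod_cast (hM v).ne'
  have hiff : ∀ p, (N.subst M a b o).transition.mulVec f p = (z • f) p ↔
      ∑ e, ∑ u, (if identify o a b e u = p then (o.weight e : ℂ) * (M.total u *
        M.transition.mulVec (fun v => f (identify o a b e v)) u) else 0) =
        (N.subst M a b o).total p * (z * f p) := by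
    intro p
    rw [← mul_right_inj' (hpC p), Network.total_mul_transition_mulVec (hpos p).ne',
      sum_subst_cond_mul]
    simp only [Network.total_mul_transition_mulVec (hM _).ne']
    rfl
  rw [funext_iff]
  constructor
  · intro h
    refine ⟨fun e v => ?_, fun x => ?_⟩
    · have h1 := (hiff _).1 (h (Sum.inr (e, v)))
      rw [sum_identify_eq_inr o hab (fun e u => M.total u *
        M.transition.mulVec (fun v => f (identify o a b e v)) u), subst_total_inr o hab,
        mul_assoc] at h1
      have h2 := mul_left_cancel₀ (hMC v) (mul_left_cancel₀ (o.weight_ne_zero e) h1)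
      simp only [h2, identify_interior]
    · have h1 := (hiff _).1 (h (Sum.inl x))
      rw [sum_identify_eq_inl o hab (fun e u => M.total u *
        M.transition.mulVec (fun v => f (identify o a b e v)) u), subst_total_inl o hab γ,
        γ.total_eq, ← o.mul_boundarySum, mul_assoc] at h1
      exact mul_left_cancel₀ (hMC a) h1
  · rintro ⟨h1, h2⟩ (x | ⟨e, v⟩)
    · rw [hiff, sum_identify_eq_inl o hab (fun e u => M.total u *
        M.transition.mulVec (fun v => f (identify o a b e v)) u), subst_total_inl o hab γ,
        γ.total_eq, ← o.mul_boundarySum, h2, mul_assoc]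
    · rw [hiff, sum_identify_eq_inr o hab (fun e u => M.total u *
        M.transition.mulVec (fun v => f (identify o a b e v)) u), subst_total_inr o hab,
        h1 e v]
      simp only [identify_interior, mul_assoc]

end Identify

/-! ### The Dirichlet problem on `V^o` and the functions `θ`, `ψ`, `φ` -/

section Resolvent

variable {V : Type*} [Fintype V] [DecidableEq V] {a b : V} {Q : Matrix V V ℂ} {z : ℂ}

theorem scalar_sub_mulVec (A : Matrix V V ℂ) (z : ℂ) (f : V → ℂ) (v : V) :
    (Matrix.scalar V z - A).mulVec f v = z * f v - A.mulVec f v := by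
  rw [Matrix.sub_mulVec, Pi.sub_apply, Matrix.scalar_apply, Matrix.mulVec_diagonal]

theorem isUnit_det_scalar_sub {A : Matrix V V ℂ} (hz : z ∉ spec A) :
    IsUnit (Matrix.scalar V z - A).det := by
  rw [isUnit_iff_ne_zero]
  intro h
  obtain ⟨f, hf, h⟩ := Matrix.exists_mulVec_eq_zero_iff.2 h
  refine hz (mem_spec_iff.2 ⟨f, hf, funext fun v => ?_⟩)
  have := congrFun h v
  rw [scalar_sub_mulVec, Pi.zero_apply, sub_eq_zero] at this
  exact this.symm

/-- The source term on the interior produced by boundary values. -/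
def boundarySource (Q : Matrix V V ℂ) (a b : V) (α β : ℂ) (v : Interior a b) : ℂ :=
  Q v a * α + Q v b * β

/-- A Dirichlet problem: boundary values act as a source for `zI - Q_{V^o}`, so the resolvent gives
existence and uniqueness. -/
theorem interiorEigen_iff_source (hab : a ≠ b) {g : V → ℂ} :
    InteriorEigen Q a b z g ↔
      (Matrix.scalar (Interior a b) z - interiorPart Q a b).mulVec (fun v => g v) =
        boundarySource Q a b (g a) (g b) := by
  rw [funext_iff]
  refine forall_congr' fun v => ?_
  rw [scalar_sub_mulVec, interiorPart_mulVec, mulVec_eq_interiorFlux hab, boundarySource,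
    sub_eq_iff_eq_add, eq_comm]

theorem InteriorEigen.eq_interiorGreen_mulVec (hab : a ≠ b) (hz : z ∉ spec (interiorPart Q a b))
    {g : V → ℂ} (hg : InteriorEigen Q a b z g) :
    (fun v : Interior a b => g v) =
      (interiorGreen Q a b z).mulVec (boundarySource Q a b (g a) (g b)) := by
  rw [← (interiorEigen_iff_source hab).1 hg, interiorGreen, Matrix.mulVec_mulVec,
    Matrix.nonsing_inv_mul _ (isUnit_det_scalar_sub hz), Matrix.one_mulVec]

theorem exists_interiorEigen (hab : a ≠ b) (hz : z ∉ spec (interiorPart Q a b)) (α β : ℂ) :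
    ∃ g : V → ℂ, g a = α ∧ g b = β ∧ InteriorEigen Q a b z g := by
  refine ⟨glue a b α β ((interiorGreen Q a b z).mulVec (boundarySource Q a b α β)),
    glue_left .., glue_right hab .., ?_⟩
  rw [interiorEigen_iff_source hab, glue_left, glue_right hab]
  simp only [glue_interior]
  change (Matrix.scalar (Interior a b) z - interiorPart Q a b).mulVec
    ((interiorGreen Q a b z).mulVec (boundarySource Q a b α β)) = _
  rw [interiorGreen, Matrix.mulVec_mulVec, Matrix.mul_nonsing_inv _ (isUnit_det_scalar_sub hz),
    Matrix.one_mulVec]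

/-- Inserting the resolvent solution into `Qg(a)` produces the double sums defining `θ` and `ψ`.
With `Q a a = 0`, the direct contribution of the boundary is `q(a,b) g(b)`, the last term of `ψ`. -/
theorem InteriorEigen.mulVec_left (hab : a ≠ b) (hz : z ∉ spec (interiorPart Q a b))
    (hQ : Q a a = 0) {g : V → ℂ} (hg : InteriorEigen Q a b z g) :
    Q.mulVec g a = theta Q a b z * g a + psi Q a b z * g b := by
  rw [mulVec_eq_interiorFlux hab, hg.eq_interiorGreen_mulVec hab hz, hQ, interiorFlux, theta, psi]
  simp only [Matrix.mulVec, dotProduct, boundarySource, Finset.mul_sum, Finset.sum_mul, add_mul,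
    mul_add, Finset.sum_add_distrib]
  rw [zero_mul, zero_add, add_comm (Q a b * g b), add_assoc]
  congr 1
  · exact Finset.sum_congr rfl fun u _ => Finset.sum_congr rfl fun v _ => by ring
  · congr 1
    exact Finset.sum_congr rfl fun u _ => Finset.sum_congr rfl fun v _ => by ring

theorem InteriorEigen.eq_zero (hab : a ≠ b) (hz : z ∉ spec (interiorPart Q a b))
    {g : V → ℂ} (hg : InteriorEigen Q a b z g) (ha : g a = 0) (hb : g b = 0) : g = 0 := by
  have h := hg.eq_interiorGreen_mulVec hab hz
  have h0 : boundarySource Q a b (g a) (g b) = 0 := by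
    funext v
    simp [boundarySource, ha, hb]
  rw [h0, Matrix.mulVec_zero] at h
  rw [← glue_self (a := a) (b := b) g, h, ha, hb]
  funext v
  simp only [glue]
  split_ifs <;> rfl

theorem InteriorEigen.mulVec_right (hab : a ≠ b) {M : Network V} (γ : M.Swap a b)
    (hz : z ∉ spec (interiorPart M.transition a b))
    {g : V → ℂ} (hg : InteriorEigen M.transition a b z g) :
    M.transition.mulVec g b =
      theta M.transition a b z * g b + psi M.transition a b z * g a := by
  have h := (hg.comp_swap γ).mulVec_left hab hz (Network.transition_self a)
  rwa [γ.mulVec_comp, γ.map_a, γ.map_b] at h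

/-- The value of a rational function at a point where a given denominator does not vanish. -/
theorem RatFunc.eval_algebraMap_div {K : Type*} [Field K] (p q : Polynomial K) (z : K)
    (hq : q.eval z ≠ 0) :
    RatFunc.eval (RingHom.id K) z (algebraMap (Polynomial K) (RatFunc K) p /
      algebraMap (Polynomial K) (RatFunc K) q) = p.eval z / q.eval z := by
  have hq0 : q ≠ 0 := by
    rintro rfl
    simp at hq
  have hq0' : algebraMap (Polynomial K) (RatFunc K) q ≠ 0 := RatFunc.algebraMap_ne_zero hq0
  rw [eq_div_iff hq]
  have h1 : Polynomial.eval₂ (RingHom.id K) z (RatFunc.denom (algebraMap (Polynomial K)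
      (RatFunc K) p / algebraMap (Polynomial K) (RatFunc K) q)) ≠ 0 := by
    intro h
    obtain ⟨r, hr⟩ := RatFunc.denom_div_dvd p q
    rw [hr, Polynomial.eval_mul] at hq
    exact hq (by rw [Polynomial.eval₂_id] at h; rw [h, zero_mul])
  have h2 : Polynomial.eval₂ (RingHom.id K) z
      (RatFunc.denom (algebraMap (Polynomial K) (RatFunc K) q)) ≠ 0 := by
    rw [RatFunc.denom_algebraMap]
    simp
  have h3 := RatFunc.eval_mul (f := RingHom.id K) (a := z) h1 h2
  rw [div_mul_cancel₀ _ hq0', RatFunc.eval_algebraMap, RatFunc.eval_algebraMap] at h3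
  simpa [Polynomial.eval₂_id] using h3.symm

/-- Cramer's rule: the determinant cancels, leaving a quotient of polynomial cofactors. It can
therefore be evaluated also at eigenvalues of `Q`. -/
theorem one_div_hitRat (Q : Matrix V V ℂ) (u v : V) :
    1 / hitRat Q u v =
      algebraMap (Polynomial ℂ) (RatFunc ℂ) (Q.charmatrix.adjugate v v) /
        algebraMap (Polynomial ℂ) (RatFunc ℂ) (Q.charmatrix.adjugate u v) := by
  have hm : Matrix.scalar V RatFunc.X - Q.map RatFunc.C =
      Q.charmatrix.map (algebraMap (Polynomial ℂ) (RatFunc ℂ)) := by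
    ext i j
    by_cases h : i = j
    · subst h
      simp [Matrix.charmatrix_apply_eq]
    · simp [h]
  have hdet : (Q.charmatrix.map (algebraMap (Polynomial ℂ) (RatFunc ℂ))).det =
      algebraMap (Polynomial ℂ) (RatFunc ℂ) Q.charpoly := by
    rw [Matrix.charpoly, RingHom.map_det, RingHom.mapMatrix_apply]
  have hne : algebraMap (Polynomial ℂ) (RatFunc ℂ) Q.charpoly ≠ 0 :=
    RatFunc.algebraMap_ne_zero Q.charpoly_monic.ne_zero
  have hadj : (Q.charmatrix.map (algebraMap (Polynomial ℂ) (RatFunc ℂ))).adjugate =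
      Q.charmatrix.adjugate.map (algebraMap (Polynomial ℂ) (RatFunc ℂ)) := by
    rw [← RingHom.mapMatrix_apply, ← RingHom.mapMatrix_apply, RingHom.map_adjugate]
  rw [hitRat, greenRat, hm, Matrix.inv_def, hdet, hadj, one_div_div, Ring.inverse_eq_inv']
  simp only [Matrix.smul_apply, Matrix.map_apply, smul_eq_mul]
  rw [mul_div_mul_left _ _ (inv_ne_zero hne)]

theorem eval_charmatrix_adjugate (Q : Matrix V V ℂ) (z : ℂ) (u v : V) :
    (Q.charmatrix.adjugate u v).eval z = (Matrix.scalar V z - Q).adjugate u v := by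
  have h : (Polynomial.evalRingHom z).mapMatrix Q.charmatrix = Matrix.scalar V z - Q := by
    ext i j
    by_cases h : i = j
    · subst h
      simp [Matrix.charmatrix_apply_eq]
    · simp [h]
  rw [← h, ← RingHom.map_adjugate]
  rfl

/-- Column `b` of the adjugate solves the eigenvalue equation at every vertex except possibly `b`.
Expressing the equation at `a` through `θ` and `ψ` gives the ratio of its entries at `b` and `a`,
which is `φ`. -/
theorem phi_mul_psi (hab : a ≠ b) (hz : z ∉ spec (interiorPart Q a b)) (hQ : Q a a = 0)
    (hψ : psi Q a b z ≠ 0) : phi Q a b z * psi Q a b z = z - theta Q a b z := by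
  set B := Matrix.scalar V z - Q with hB
  -- The cofactor is the determinant of `B` with row `b` replaced by the unit vector at `a`. A
  -- kernel vector vanishes at `a` and solves the equation off `b`; then `ψ f(b) = 0`, so `f`
  -- vanishes at both boundary points and hence everywhere.
  have hne : B.adjugate a b ≠ 0 := by
    rw [Matrix.adjugate_apply]
    intro h
    obtain ⟨f, hf, h⟩ := Matrix.exists_mulVec_eq_zero_iff.2 h
    have hrow : ∀ v, v ≠ b → Q.mulVec f v = z * f v := fun v hv => by
      have := congrFun h v
      rw [Matrix.mulVec, Matrix.updateRow_ne hv] at this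
      have h2 := scalar_sub_mulVec Q z f v
      rw [← hB, Matrix.mulVec, this] at h2
      exact (sub_eq_zero.1 h2.symm).symm
    have hfa : f a = 0 := by
      have := congrFun h b
      rw [Matrix.mulVec, Matrix.updateRow_self] at this
      simpa using this
    have hint : InteriorEigen Q a b z f := fun v => hrow v v.2.2
    have h1 := hint.mulVec_left hab hz hQ
    rw [hrow a hab, hfa, mul_zero, mul_zero, zero_add] at h1
    exact hf (hint.eq_zero hab hz hfa ((mul_eq_zero.1 h1.symm).resolve_left hψ))
  have hcol : ∀ v, v ≠ b → Q.mulVec (fun u => B.adjugate u b) v = z * B.adjugate v b := by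
    intro v hv
    have h1 := scalar_sub_mulVec Q z (fun u => B.adjugate u b) v
    have h2 : (B * B.adjugate) v b = 0 := by
      rw [Matrix.mul_adjugate]
      simp [hv]
    rw [← hB, show B.mulVec (fun u => B.adjugate u b) v = (B * B.adjugate) v b from rfl, h2] at h1
    exact (sub_eq_zero.1 h1.symm).symm
  have hint : InteriorEigen Q a b z (fun u => B.adjugate u b) := fun v => hcol v v.2.2
  have h1 := hint.mulVec_left hab hz hQ
  rw [hcol a hab] at h1
  rw [phi, one_div_hitRat, RatFunc.eval_algebraMap_div, eval_charmatrix_adjugate,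
    eval_charmatrix_adjugate, ← hB, div_mul_eq_mul_div, div_eq_iff hne]
  · linear_combination -h1
  · rwa [eval_charmatrix_adjugate]

end Resolvent

/-! ### The spectrum of `P_*` outside `spec(Q_{V^o})` -/

section OutsideInterior

variable {X V : Type*} [Fintype X] [DecidableEq X] [Fintype V] [DecidableEq V]
  {N : Network X} {M : Network V} (o : N.Orientation) {a b : V} {z : ℂ}

theorem mem_spec_subst_iff_of_notMem (hab : a ≠ b) (γ : M.Swap a b) (hN : ∀ x, 0 < N.total x)
    (hM : ∀ v, 0 < M.total v) (hz : z ∉ spec (interiorPart M.transition a b)) :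
    z ∈ spec (N.subst M a b o).transition ↔ ∃ s : X → ℂ, s ≠ 0 ∧ ∀ x,
      theta M.transition a b z * s x + psi M.transition a b z * N.transition.mulVec s x =
        z * s x := by
  have hNC : ∀ x, (N.total x : ℂ) ≠ 0 := fun x => by exact_mod_cast (hN x).ne'
  -- The diagonal part `θ` sees the value at the edge's own end and sums to `m(x) s(x)`; the part
  -- `ψ` sees the opposite end and sums to `m(x) Ps(x)`.
  have key : ∀ (s : X → ℂ) (g : N.Edge → V → ℂ),
      (∀ e, InteriorEigen M.transition a b z (g e)) → (∀ e, g e a = s (o.init e)) →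
      (∀ e, g e b = s (o.term e)) → ∀ x,
      o.boundarySum (fun e => M.transition.mulVec (g e) a)
        (fun e => M.transition.mulVec (g e) b) x = N.total x *
          (theta M.transition a b z * s x +
            psi M.transition a b z * N.transition.mulVec s x) := by
    intro s g hg ha hb x
    have h1 : o.boundarySum (fun e => M.transition.mulVec (g e) a)
        (fun e => M.transition.mulVec (g e) b) x =
        theta M.transition a b z * o.boundarySum (fun e => s (o.init e) * 1)
          (fun e => s (o.term e) * 1) x +
        psi M.transition a b z * o.boundarySum (fun e => s (o.term e))
          (fun e => s (o.init e)) x := by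
      rw [o.mul_boundarySum, o.mul_boundarySum, o.boundarySum_add]
      congr 1
      · funext e
        rw [(hg e).mulVec_left hab hz (Network.transition_self a), ha, hb, Pi.add_apply, mul_one]
      · funext e
        rw [(hg e).mulVec_right hab γ hz, ha, hb, Pi.add_apply, mul_one]
    rw [h1, o.boundarySum_mul_endpoint, o.boundarySum_one, o.boundarySum_neighbors,
      ← Network.total_mul_transition_mulVec (hN x).ne']
    ring
  rw [mem_spec_iff]
  constructor
  · rintro ⟨f, hf, hfz⟩
    obtain ⟨h1, h2⟩ := (subst_mulVec_eq_smul_iff o hab γ hN hM f z).1 hfz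
    refine ⟨fun x => f (Sum.inl x), fun hs => hf ?_, fun x => ?_⟩
    · have hs' : ∀ x, f (Sum.inl x) = 0 := fun x => congrFun hs x
      refine eq_zero_of_comp_identify_eq_zero o (a := a) (b := b) hs' fun e v => ?_
      have := (h1 e).eq_zero hab hz (by simp [hs']) (by simp [identify_right o hab, hs'])
      exact congrFun this v
    · have := key (fun x => f (Sum.inl x)) (fun e v => f (identify o a b e v)) h1
        (fun e => by simp) (fun e => by simp [identify_right o hab]) x
      rw [h2] at this
      exact (mul_left_cancel₀ (hNC x) this).symm
  · rintro ⟨s, hs, hsz⟩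
    choose g ha hb hg using fun e : N.Edge =>
      exists_interiorEigen hab hz (s (o.init e)) (s (o.term e))
    obtain ⟨f, hf1, hf2⟩ := exists_comp_identify_eq o hab s g ha hb
    refine ⟨f, fun h => hs (funext fun x => by rw [← hf1, h]; rfl), ?_⟩
    rw [subst_mulVec_eq_smul_iff o hab γ hN hM]
    simp only [hf2, hf1]
    exact ⟨hg, fun x => by rw [key s g hg ha hb, hsz]⟩

theorem mem_spec_subst_iff_mem_S1_union_S2 [Nonempty X] (hab : a ≠ b) (γ : M.Swap a b)
    (hN : ∀ x, 0 < N.total x) (hM : ∀ v, 0 < M.total v)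
    (hz : z ∉ spec (interiorPart M.transition a b)) :
    z ∈ spec (N.subst M a b o).transition ↔
      z ∈ S1 N.transition M.transition a b ∪ S2 M.transition a b := by
  have hiff := mem_spec_subst_iff_of_notMem o hab γ hN hM hz
  constructor
  · intro h
    have hreal := Network.spec_transition_subset (subst_total_pos o hab γ hN hM) h
    obtain ⟨s, hs, hsz⟩ := hiff.1 h
    by_cases hψ : psi M.transition a b z = 0
    · refine Or.inr ⟨hreal, hz, hψ, ?_⟩
      obtain ⟨x, hx⟩ := Function.ne_iff.1 hs
      have := hsz x
      rw [hψ, zero_mul, add_zero] at this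
      exact mul_right_cancel₀ hx this
    · refine Or.inl ⟨hreal, hz, hψ, mem_spec_iff.2 ⟨s, hs, funext fun x => ?_⟩⟩
      have h1 := phi_mul_psi hab hz (Network.transition_self a) hψ
      refine mul_left_cancel₀ hψ ?_
      rw [Pi.smul_apply, smul_eq_mul]
      linear_combination hsz x - s x * h1
  · rintro (⟨-, -, hψ, h⟩ | ⟨-, -, hψ, h⟩)
    · obtain ⟨s, hs, hsz⟩ := mem_spec_iff.1 h
      refine hiff.2 ⟨s, hs, fun x => ?_⟩
      have h1 := phi_mul_psi hab hz (Network.transition_self a) hψ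
      rw [hsz, Pi.smul_apply, smul_eq_mul]
      linear_combination s x * h1
    -- With `ψ = 0` and `θ = z` the equation holds for every `s`; a nonzero constant suffices.
    · exact hiff.2 ⟨fun _ => 1, fun h => one_ne_zero (congrFun h (Classical.arbitrary X)),
        fun x => by rw [hψ, h]; ring⟩

end OutsideInterior

/-! ### Eigenfunctions over `X[V]` built from eigenfunctions over `V` or `V^o` -/

section Constructions

theorem mulVec_comp_swap_eq {V : Type*} [Fintype V] {M : Network V} {a b : V} {z : ℂ} (γ : M.Swap a b) {h : V → ℂ} (hz : M.transition.mulVec h = z • h) :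
    M.transition.mulVec (fun v => h (γ.perm v)) = z • fun v => h (γ.perm v) := by
  funext v
  rw [γ.mulVec_comp, hz]
  rfl

variable {X V : Type*} [Fintype X] [DecidableEq X] [Fintype V] [DecidableEq V]
  {N : Network X} {M : Network V} (o : N.Orientation) {a b : V} {z : ℂ}

theorem mem_spec_subst_of_glue (hab : a ≠ b) (γ : M.Swap a b) (hN : ∀ x, 0 < N.total x)
    (hM : ∀ v, 0 < M.total v) (s : X → ℂ) (g : N.Edge → V → ℂ)
    (ha : ∀ e, g e a = s (o.init e)) (hb : ∀ e, g e b = s (o.term e))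
    (hg : ∀ e, InteriorEigen M.transition a b z (g e))
    (hs : ∀ x, o.boundarySum (fun e => M.transition.mulVec (g e) a)
      (fun e => M.transition.mulVec (g e) b) x = N.total x * (z * s x)) (hne : g ≠ 0) :
    z ∈ spec (N.subst M a b o).transition := by
  obtain ⟨f, hf1, hf2⟩ := exists_comp_identify_eq o hab s g ha hb
  refine mem_spec_iff.2 ⟨f, fun h => hne ?_, ?_⟩
  · funext e v
    rw [← hf2, h]
    rfl
  · rw [subst_mulVec_eq_smul_iff o hab γ hN hM]
    simp only [hf2, hf1]
    exact ⟨hg, hs⟩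

theorem mem_spec_subst_of_interior (hab : a ≠ b) (γ : M.Swap a b) (hN : ∀ x, 0 < N.total x)
    (hM : ∀ v, 0 < M.total v) (g : N.Edge → Interior a b → ℂ)
    (hg : ∀ e, g e ∈ eigenspaceOf (interiorPart M.transition a b) z)
    (hs : ∀ x, o.boundarySum (fun e => interiorFlux M.transition (g e) a)
      (fun e => interiorFlux M.transition (g e) b) x = 0) (hne : g ≠ 0) :
    z ∈ spec (N.subst M a b o).transition := by
  refine mem_spec_subst_of_glue o hab γ hN hM 0 (fun e => glue a b 0 0 (g e))
    (fun e => by simp) (fun e => by simp [glue_right hab])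
    (fun e => (mem_eigenspaceOf_interiorPart hab).1 (hg e)) (fun x => ?_) fun h => hne ?_
  · simp only [← interiorFlux_eq_mulVec_glue hab]
    rw [hs]
    simp
  · funext e v
    rw [← glue_interior 0 0 (g e) v]
    exact congrFun (congrFun h e) v

/-- Place `σ(e^a) h` on the copy `e`. The two conditions involving `ε` make the copies agree on `X`,
with common value `σ x * h a`. The intended cases are `ε = 1` with `σ = 1`, and `ε = -1` with a
2-colouring. -/
theorem mem_spec_subst_of_signed [Nonempty N.Edge] (hab : a ≠ b) (γ : M.Swap a b)
    (hN : ∀ x, 0 < N.total x) (hM : ∀ v, 0 < M.total v) {h : V → ℂ} (hh : h ≠ 0)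
    (hz : M.transition.mulVec h = z • h) (ε : ℂ) (hε : h b = ε * h a) (σ : X → ℂ)
    (hσ0 : ∀ x, σ x ≠ 0) (hσ : ∀ e, σ (o.term e) = ε * σ (o.init e)) :
    z ∈ spec (N.subst M a b o).transition := by
  have hz' : ∀ v, M.transition.mulVec h v = z * h v := fun v => by rw [hz]; rfl
  refine mem_spec_subst_of_glue o hab γ hN hM (fun x => σ x * h a)
    (fun e v => σ (o.init e) * h v) (fun e => rfl) (fun e => ?_) (fun e v => ?_) (fun x => ?_)
    fun h0 => hh ?_
  · rw [hε, hσ]; ring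
  · have : (fun v => σ (o.init e) * h v) = σ (o.init e) • h := rfl
    rw [this, Matrix.mulVec_smul, Pi.smul_apply, Pi.smul_apply, hz', smul_eq_mul, smul_eq_mul]
    ring
  · have h1 : ∀ e, (fun v => σ (o.init e) * h v) = σ (o.init e) • h := fun e => rfl
    have h2 : o.boundarySum (fun e => M.transition.mulVec (fun v => σ (o.init e) * h v) a)
        (fun e => M.transition.mulVec (fun v => σ (o.init e) * h v) b) x =
        o.boundarySum (fun e => (z * h a * σ (o.init e)) * 1)
          (fun e => (z * h a * σ (o.term e)) * 1) x := by
      congr 1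
      · funext e
        rw [h1, Matrix.mulVec_smul, Pi.smul_apply, hz', smul_eq_mul]
        ring
      · funext e
        rw [h1, Matrix.mulVec_smul, Pi.smul_apply, hz', smul_eq_mul, hσ, hε]
        ring
    rw [h2, o.boundarySum_mul_endpoint (fun x => z * h a * σ x), o.boundarySum_one]
    ring
  · funext v
    obtain ⟨e⟩ := ‹Nonempty N.Edge›
    exact (mul_eq_zero.1 (congrFun (congrFun h0 e) v)).resolve_left (hσ0 _)

theorem eq_zero_of_notMem_spec_subst [Nonempty N.Edge] (hab : a ≠ b) (γ : M.Swap a b)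
    (hN : ∀ x, 0 < N.total x) (hM : ∀ v, 0 < M.total v)
    (hz : z ∉ spec (N.subst M a b o).transition) {h : V → ℂ}
    (hh : M.transition.mulVec h = z • h) (hba : h b = h a) : h = 0 := by
  by_contra h0
  exact hz (mem_spec_subst_of_signed o hab γ hN hM h0 hh 1 (by rw [hba, one_mul]) (fun _ => 1)
    (fun _ => one_ne_zero) fun _ => by ring)

theorem comp_swap_eq_neg_of_notMem_spec_subst [Nonempty N.Edge] (hab : a ≠ b) (γ : M.Swap a b)
    (hN : ∀ x, 0 < N.total x) (hM : ∀ v, 0 < M.total v)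
    (hz : z ∉ spec (N.subst M a b o).transition) {h : V → ℂ}
    (hh : M.transition.mulVec h = z • h) (v : V) : h (γ.perm v) = -h v := by
  -- The symmetrization `h + h ∘ γ` takes equal values at `a` and `b`, so it must vanish.
  have h1 := eq_zero_of_notMem_spec_subst o hab γ hN hM hz
    (h := h + fun v => h (γ.perm v)) (by
      rw [Matrix.mulVec_add, hh, mulVec_comp_swap_eq γ hh, smul_add])
    (by simp only [Pi.add_apply, γ.map_a, γ.map_b]; ring)
  have := congrFun h1 v
  simp only [Pi.add_apply, Pi.zero_apply] at this
  linear_combination this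

/-- If `z` were missing, its eigenfunctions would be antisymmetric under `γ`; but those spread over
`X[V]` with the signs of a 2-colouring. -/
theorem spec_subset_spec_subst_of_isBipartite [Nonempty N.Edge] (hab : a ≠ b) (γ : M.Swap a b)
    (hN : ∀ x, 0 < N.total x) (hM : ∀ v, 0 < M.total v) (hb : N.graph.IsBipartite) :
    spec M.transition ⊆ spec (N.subst M a b o).transition := by
  intro z hz
  by_contra hz'
  obtain ⟨h, h0, hh⟩ := mem_spec_iff.1 hz
  obtain ⟨χ⟩ := hb
  refine hz' (mem_spec_subst_of_signed o hab γ hN hM h0 hh (-1) ?_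
    (fun x => if χ x = 0 then 1 else -1) (fun x => ?_) fun e => ?_)
  · have := comp_swap_eq_neg_of_notMem_spec_subst o hab γ hN hM hz' hh a
    rw [γ.map_a] at this
    rw [this]; ring
  · split_ifs <;> simp
  · have := χ.valid (o.adj e)
    generalize χ (o.init e) = i at *
    generalize χ (o.term e) = j at *
    fin_cases i <;> fin_cases j <;> simp_all

end Constructions

/-! ### Explicit bases, and type (III) for missing eigenvalues of `Q` -/

section Bases

variable {W : Type*} {E : Submodule ℂ (W → ℂ)}

theorem exists_basis_of_forall_smul (f : E) (h0 : f ≠ 0) (h : ∀ g : E, ∃ c : ℂ, g = c • f) :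
    ∃ B : Module.Basis (Fin (0 + 1)) ℂ E, B (Fin.last 0) = f := by
  have hli : LinearIndependent ℂ (fun _ : Fin 1 => f) :=
    LinearIndependent.of_subsingleton (0 : Fin 1) h0
  refine ⟨Module.Basis.mk hli ?_, by rw [Module.Basis.mk_apply]⟩
  · intro g _
    obtain ⟨c, rfl⟩ := h g
    exact Submodule.smul_mem _ _ (Submodule.subset_span ⟨0, rfl⟩)

theorem exists_basis_of_forall_pair (f g : E)
    (hli : ∀ c d : ℂ, c • f + d • g = 0 → c = 0 ∧ d = 0)
    (h : ∀ u : E, ∃ c d : ℂ, u = c • f + d • g) :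
    ∃ B : Module.Basis (Fin (0 + 2)) ℂ E, B (Fin.last 0).castSucc = f ∧
      B (Fin.last (0 + 1)) = g := by
  have hli' : LinearIndependent ℂ ![f, g] := LinearIndependent.pair_iff.2 hli
  refine ⟨Module.Basis.mk (v := ![f, g]) hli' ?_, ?_, ?_⟩
  · intro u _
    obtain ⟨c, d, rfl⟩ := h u
    exact Submodule.add_mem _ (Submodule.smul_mem _ _ (Submodule.subset_span ⟨0, rfl⟩))
      (Submodule.smul_mem _ _ (Submodule.subset_span ⟨1, rfl⟩))
  · rw [Module.Basis.mk_apply]; rfl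
  · rw [Module.Basis.mk_apply]; rfl

end Bases

section TypeIII

variable {X V : Type*} [Fintype X] [DecidableEq X] [Fintype V] [DecidableEq V]
  {N : Network X} {M : Network V} (o : N.Orientation) {a b : V} {z : ℂ}

/-- All eigenfunctions are antisymmetric, so one vanishing at `a` also vanishes at `b` and is zero.
Evaluation at `a` is thus injective and the eigenspace is a line. -/
theorem hasTypeIII_of_notMem_spec_subst [Nonempty N.Edge] (hab : a ≠ b) (γ : M.Swap a b)
    (hN : ∀ x, 0 < N.total x) (hM : ∀ v, 0 < M.total v) (hz : z ∈ spec M.transition)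
    (hz' : z ∉ spec (N.subst M a b o).transition) :
    HasTypeIII M γ z ∧ mult M.transition z = 1 := by
  have hneg : ∀ h : V → ℂ, M.transition.mulVec h = z • h → h b = -h a := fun h hh => by
    rw [← comp_swap_eq_neg_of_notMem_spec_subst o hab γ hN hM hz' hh a, γ.map_a]
  have hinj : ∀ h : V → ℂ, M.transition.mulVec h = z • h → h a = 0 → h = 0 := fun h hh ha =>
    eq_zero_of_notMem_spec_subst o hab γ hN hM hz' hh (by rw [hneg h hh, ha, neg_zero])
  obtain ⟨h, h0, hh⟩ := mem_spec_iff.1 hz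
  have ha : h a ≠ 0 := fun ha => h0 (hinj h hh ha)
  set f : V → ℂ := (h a)⁻¹ • h with hf
  have hfz : M.transition.mulVec f = z • f := by
    rw [hf, Matrix.mulVec_smul, hh, smul_comm]
  have hfa : f a = 1 := by simp [hf, ha]
  obtain ⟨B, hB⟩ := exists_basis_of_forall_smul
    (⟨f, mem_eigenspaceOf_iff.2 hfz⟩ : eigenspaceOf M.transition z)
    (fun h => by
      have := congrFun (congrArg Subtype.val h) a
      simp [hfa] at this)
    (fun g => ⟨g.1 a, Subtype.ext (by
      have hg := mem_eigenspaceOf_iff.1 g.2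
      have := hinj (g.1 - g.1 a • f) (by
        rw [Matrix.mulVec_sub, Matrix.mulVec_smul, hg, hfz, smul_sub, smul_comm])
        (by simp [hfa])
      exact sub_eq_zero.1 this)⟩)
  refine ⟨⟨0, B, fun j => j.elim0, ?_⟩, ?_⟩
  · rw [hB]
    exact ⟨hfa, (hneg f hfz).trans (by rw [hfa]),
      comp_swap_eq_neg_of_notMem_spec_subst o hab γ hN hM hz' hfz⟩
  · rw [mult, Module.finrank_eq_card_basis B]
    simp

end TypeIII

/-! ### Classification of eigenvalues of `Q_{V^o}` by fluxes -/

section FluxTypes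

variable {V : Type*} [Fintype V] [DecidableEq V] {M : Network V} {a b : V} {z : ℂ}

/-- The eigenspace of the interior part is spanned by one function with fluxes `1` and `-ε`. -/
def IsFluxLine (Q : Matrix V V ℂ) (a b : V) (z ε : ℂ) : Prop :=
  ∃ f ∈ eigenspaceOf (interiorPart Q a b) z, interiorFlux Q f a = 1 ∧ interiorFlux Q f b = -ε ∧
    ∀ g ∈ eigenspaceOf (interiorPart Q a b) z, ∃ c : ℂ, g = c • f

/-- The eigenspace of the interior part is spanned by two functions with fluxes `(1,0)`
and `(0,1)`. -/
def IsFluxPlane (Q : Matrix V V ℂ) (a b : V) (z : ℂ) : Prop :=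
  ∃ f ∈ eigenspaceOf (interiorPart Q a b) z, ∃ g ∈ eigenspaceOf (interiorPart Q a b) z,
    (interiorFlux Q f a = 1 ∧ interiorFlux Q f b = 0) ∧
    (interiorFlux Q g a = 0 ∧ interiorFlux Q g b = 1) ∧
    ∀ u ∈ eigenspaceOf (interiorPart Q a b) z, ∃ c d : ℂ, u = c • f + d • g

theorem interiorFlux_add (Q : Matrix V V ℂ) (f g : Interior a b → ℂ) (w : V) :
    interiorFlux Q (f + g) w = interiorFlux Q f w + interiorFlux Q g w := by
  simp [interiorFlux, mul_add, Finset.sum_add_distrib]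

theorem interiorFlux_smul (Q : Matrix V V ℂ) (c : ℂ) (f : Interior a b → ℂ) (w : V) :
    interiorFlux Q (c • f) w = c * interiorFlux Q f w := by
  simp only [interiorFlux, Pi.smul_apply, smul_eq_mul, Finset.mul_sum]
  exact Finset.sum_congr rfl fun v _ => by ring

theorem interiorFlux_zero (Q : Matrix V V ℂ) (w : V) :
    interiorFlux Q (0 : Interior a b → ℂ) w = 0 := by
  simp [interiorFlux]

theorem isFluxLine_of_hasTypeIIo (γ : M.Swap a b)
    (hm : mult (interiorPart M.transition a b) z = 1) (h : HasTypeIIo M γ z) :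
    IsFluxLine M.transition a b z (-1) := by
  obtain ⟨n, f, -, ha, hb, -⟩ := h
  rw [mult, Module.finrank_eq_card_basis f, Fintype.card_fin, Nat.add_eq_right] at hm
  subst hm
  refine ⟨_, (f (Fin.last 0)).2, ha, by rw [hb, neg_neg], fun g hg => ?_⟩
  refine ⟨f.repr ⟨g, hg⟩ 0, ?_⟩
  have := congrArg Subtype.val (f.sum_repr ⟨g, hg⟩)
  simpa using this.symm

theorem isFluxLine_of_hasTypeIIIo (γ : M.Swap a b)
    (hm : mult (interiorPart M.transition a b) z = 1) (h : HasTypeIIIo M γ z) :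
    IsFluxLine M.transition a b z 1 := by
  obtain ⟨n, f, -, ha, hb, -⟩ := h
  rw [mult, Module.finrank_eq_card_basis f, Fintype.card_fin, Nat.add_eq_right] at hm
  subst hm
  refine ⟨_, (f (Fin.last 0)).2, ha, hb, fun g hg => ?_⟩
  refine ⟨f.repr ⟨g, hg⟩ 0, ?_⟩
  have := congrArg Subtype.val (f.sum_repr ⟨g, hg⟩)
  simpa using this.symm

theorem isFluxPlane_of_hasTypeIVo (γ : M.Swap a b)
    (hm : mult (interiorPart M.transition a b) z = 2) (h : HasTypeIVo M γ z) :
    IsFluxPlane M.transition a b z := by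
  obtain ⟨n, f, -, ha, hb, hb0, ha0, -⟩ := h
  rw [mult, Module.finrank_eq_card_basis f, Fintype.card_fin, Nat.add_eq_right] at hm
  subst hm
  refine ⟨_, (f (Fin.last (0 + 1))).2, _, (f (Fin.last 0).castSucc).2, ⟨ha, hb0⟩, ⟨ha0, hb⟩,
    fun g hg => ⟨f.repr ⟨g, hg⟩ 1, f.repr ⟨g, hg⟩ 0, ?_⟩⟩
  have := congrArg Subtype.val (f.sum_repr ⟨g, hg⟩)
  rw [Fin.sum_univ_two, add_comm] at this
  exact this.symm

theorem comp_onInterior_mem (hab : a ≠ b) (γ : M.Swap a b) {f : Interior a b → ℂ}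
    (hf : f ∈ eigenspaceOf (interiorPart M.transition a b) z) :
    (fun v => f (γ.onInterior v)) ∈ eigenspaceOf (interiorPart M.transition a b) z ∧
      interiorFlux M.transition (fun v => f (γ.onInterior v)) a = interiorFlux M.transition f b ∧
      interiorFlux M.transition (fun v => f (γ.onInterior v)) b =
        interiorFlux M.transition f a := by
  have hg := ((mem_eigenspaceOf_interiorPart hab).1 hf).comp_swap γ
  set g : V → ℂ := fun v => glue a b 0 0 f (γ.perm v) with hgdef
  have ha : g a = 0 := by simp [hgdef, γ.map_a, glue_right hab]
  have hb : g b = 0 := by simp [hgdef, γ.map_b]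
  have hr : (fun v : Interior a b => g v) = fun v => f (γ.onInterior v) := by
    funext v
    exact glue_interior 0 0 f (γ.onInterior v)
  have hflux := interiorFlux_restrict hab M.transition ha hb
  rw [hr] at hflux
  refine ⟨hr ▸ hg.restrict_mem hab ha hb, ?_, ?_⟩
  · rw [hflux, γ.mulVec_comp, γ.map_a, interiorFlux_eq_mulVec_glue hab]
  · rw [hflux, γ.mulVec_comp, γ.map_b, interiorFlux_eq_mulVec_glue hab]

/-- An interior eigenvalue none of whose eigenfunctions has flux zero. -/
theorem types_of_flux_injective (hab : a ≠ b) (γ : M.Swap a b)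
    (hz : z ∈ spec (interiorPart M.transition a b))
    (hinj : ∀ f ∈ eigenspaceOf (interiorPart M.transition a b) z,
      interiorFlux M.transition f a = 0 → interiorFlux M.transition f b = 0 → f = 0) :
    (mult (interiorPart M.transition a b) z = 1 ∧ HasTypeIIo M γ z) ∨
      (mult (interiorPart M.transition a b) z = 1 ∧ HasTypeIIIo M γ z) ∨
      (mult (interiorPart M.transition a b) z = 2 ∧ HasTypeIVo M γ z) := by
  set E := eigenspaceOf (interiorPart M.transition a b) z with hE
  set Φ : (Interior a b → ℂ) → V → ℂ := interiorFlux M.transition with hΦ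
  have hadd : ∀ f g w, Φ (f + g) w = Φ f w + Φ g w := interiorFlux_add _
  have hsmul : ∀ (c : ℂ) f w, Φ (c • f) w = c * Φ f w := interiorFlux_smul _
  have hzero : ∀ w, Φ 0 w = 0 := interiorFlux_zero _
  have hext : ∀ f ∈ E, ∀ g ∈ E, Φ f a = Φ g a → Φ f b = Φ g b → f = g := by
    intro f hf g hg h1 h2
    have hsub : f - g = f + (-1 : ℂ) • g := by rw [neg_one_smul, sub_eq_add_neg]
    refine sub_eq_zero.1 (hinj _ (E.sub_mem hf hg) ?_ ?_)
    · rw [hsub, hadd, hsmul, h1]; ring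
    · rw [hsub, hadd, hsmul, h2]; ring
  have hγ : ∀ f ∈ E, (fun v => f (γ.onInterior v)) ∈ E ∧
      Φ (fun v => f (γ.onInterior v)) a = Φ f b ∧ Φ (fun v => f (γ.onInterior v)) b = Φ f a :=
    fun f hf => comp_onInterior_mem hab γ hf
  -- The fluxes embed `E` into `ℂ²` with an image invariant under exchanging coordinates. If `(1,0)`
  -- lies in it, so does `(0,1)`, and the image is everything.
  by_cases hplane : ∃ f ∈ E, Φ f a = 1 ∧ Φ f b = 0
  · right; right
    obtain ⟨f, hf, ha, hb⟩ := hplane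
    obtain ⟨hg, hga, hgb⟩ := hγ f hf
    set g : Interior a b → ℂ := fun v => f (γ.onInterior v) with hgdef
    rw [hb] at hga
    rw [ha] at hgb
    obtain ⟨B, hB1, hB2⟩ := exists_basis_of_forall_pair (⟨g, hg⟩ : E) (⟨f, hf⟩ : E)
      (fun c d h => by
        have h' : c • g + d • f = 0 := congrArg Subtype.val h
        constructor
        · have h1 : Φ (c • g + d • f) b = 0 := by rw [h', hzero]
          rw [hadd, hsmul, hsmul, hgb, hb] at h1
          linear_combination h1
        · have h1 : Φ (c • g + d • f) a = 0 := by rw [h', hzero]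
          rw [hadd, hsmul, hsmul, hga, ha] at h1
          linear_combination h1)
      (fun u => ⟨Φ u.1 b, Φ u.1 a, Subtype.ext (hext _ u.2 _
        (E.add_mem (E.smul_mem _ hg) (E.smul_mem _ hf))
        (by
          change _ = Φ (_ • g + _ • f) a
          rw [hadd, hsmul, hsmul, hga, ha]; ring)
        (by
          change _ = Φ (_ • g + _ • f) b
          rw [hadd, hsmul, hsmul, hgb, hb]; ring))⟩)
    refine ⟨by rw [mult, Module.finrank_eq_card_basis B]; simp, 0, B, fun j => j.elim0, ?_⟩
    rw [hB1, hB2]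
    refine ⟨ha, hgb, hb, hga, fun v => rfl, fun v => ?_⟩
    obtain ⟨hk, hka, hkb⟩ := hγ g hg
    exact congrFun (hext _ hk _ hf (by rw [hka, hgb, ha]) (by rw [hkb, hga, hb])) v
  · have hline : ∀ f ∈ E, ∀ c : ℂ, Φ f a = 1 → Φ f b = c → c * c = 1 →
        ∀ g ∈ E, g = Φ g a • f := by
      intro f hf c ha hb hc g hg
      refine hext _ hg _ (E.smul_mem _ hf) (by rw [hsmul, ha, mul_one]) ?_
      rw [hsmul, hb]
      by_contra hne
      -- Subtracting `c Φ(g)(b) f` from `g` removes the flux at `b`, because `c² = 1`. If the flux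
      -- at `a` survived, rescaling would give `(1,0)`.
      refine hplane ⟨(Φ g a - c * Φ g b)⁻¹ • (g + (-(c * Φ g b)) • f), ?_, ?_, ?_⟩
      · exact E.smul_mem _ (E.add_mem hg (E.smul_mem _ hf))
      · have hne' : Φ g a - c * Φ g b ≠ 0 := fun h => hne (by linear_combination (-c) * h - Φ g b * hc)
        rw [hsmul, hadd, hsmul, ha, mul_one, ← sub_eq_add_neg, inv_mul_cancel₀ hne']
      · rw [hsmul, hadd, hsmul, hb]
        linear_combination (-(Φ g a - c * Φ g b)⁻¹ * Φ g b) * hc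
    have hbasis : ∀ f ∈ E, ∀ c : ℂ, Φ f a = 1 → Φ f b = c → c * c = 1 →
        mult (interiorPart M.transition a b) z = 1 ∧ (∀ v, f (γ.onInterior v) = c * f v) ∧
        ∃ B : Module.Basis (Fin (0 + 1)) ℂ E, (B (Fin.last 0)).1 = f := by
      intro f hf c ha hb hc
      obtain ⟨B, hB⟩ := exists_basis_of_forall_smul (⟨f, hf⟩ : E)
        (fun h => by
          have h' : f = 0 := congrArg Subtype.val h
          rw [h', hzero] at ha
          exact zero_ne_one ha)
        (fun g => ⟨Φ g.1 a, Subtype.ext (hline f hf c ha hb hc _ g.2)⟩)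
      refine ⟨by rw [mult, Module.finrank_eq_card_basis B]; simp, fun v => ?_, B, by rw [hB]⟩
      obtain ⟨hk, hka, hkb⟩ := hγ f hf
      have := congrFun (hline f hf c ha hb hc _ hk) v
      rw [hka, hb] at this
      exact this
    obtain ⟨f, hf0, hf⟩ := mem_spec_iff.1 hz
    have hfE : f ∈ E := mem_eigenspaceOf_iff.2 hf
    obtain ⟨hgE, hga, hgb⟩ := hγ f hfE
    set g : Interior a b → ℂ := fun v => f (γ.onInterior v) with hgdef
    -- With zero sum, `f` itself has fluxes proportional to `(1,-1)`; otherwise `f + f ∘ γ` has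
    -- equal nonzero fluxes.
    by_cases hsum : Φ f a + Φ f b = 0
    · right; left
      have ha0 : Φ f a ≠ 0 := fun h => hf0 (hinj f hfE h (by
        have : Φ f b = 0 := by linear_combination hsum - h
        exact this))
      obtain ⟨hm, hcomp, B, hB⟩ := hbasis ((Φ f a)⁻¹ • f) (E.smul_mem _ hfE) (-1)
        (by rw [hsmul, inv_mul_cancel₀ ha0])
        (by rw [hsmul, show Φ f b = -Φ f a by linear_combination hsum, mul_neg,
          inv_mul_cancel₀ ha0]) (by ring)
      refine ⟨hm, 0, B, fun j => j.elim0, ?_⟩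
      rw [hB]
      exact ⟨by change Φ _ _ = _; rw [hsmul, inv_mul_cancel₀ ha0], by
        change Φ _ _ = _
        rw [hsmul, show Φ f b = -Φ f a by linear_combination hsum, mul_neg,
          inv_mul_cancel₀ ha0], fun v => by rw [hcomp]; ring⟩
    · left
      have h1 : Φ ((Φ f a + Φ f b)⁻¹ • (f + g)) a = 1 := by
        rw [hsmul, hadd, hga, inv_mul_cancel₀ hsum]
      have h2 : Φ ((Φ f a + Φ f b)⁻¹ • (f + g)) b = 1 := by
        rw [hsmul, hadd, hgb, add_comm (Φ f b), inv_mul_cancel₀ hsum]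
      obtain ⟨hm, hcomp, B, hB⟩ := hbasis ((Φ f a + Φ f b)⁻¹ • (f + g))
        (E.smul_mem _ (E.add_mem hfE hgE)) 1 h1 h2 (by ring)
      refine ⟨hm, 0, B, fun j => j.elim0, ?_⟩
      rw [hB]
      exact ⟨h1, h2, fun v => by rw [hcomp]; ring⟩

end FluxTypes

/-! ### Kernels of signed incidence matrices -/

section IncidenceKernel

variable {X : Type*} {N : Network X} (o : N.Orientation)

namespace Network.Orientation

/-- Functions which change by the factor `ε` along every edge have constant square. -/
theorem sq_eq_of_signed (hN : N.graph.Connected) {ε : ℂ} (hε : ε * ε = 1) {s : X → ℂ}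
    (hs : ∀ e, s (o.init e) = ε * s (o.term e)) (x y : X) : s x * s x = s y * s y := by
  obtain ⟨w⟩ := hN.preconnected x y
  induction w with
  | nil => rfl
  | cons h _ ih =>
    rw [← ih]
    obtain ⟨e, ⟨rfl, rfl⟩ | ⟨rfl, rfl⟩⟩ := o.exists_edge h
    · rw [hs]
      linear_combination (s (o.term e) * s (o.term e)) * hε
    · rw [hs]
      linear_combination -(s (o.term e) * s (o.term e)) * hε

theorem eq_zero_of_signed (hN : N.graph.Connected) {ε : ℂ} (hε : ε * ε = 1) {s : X → ℂ}
    (hs : ∀ e, s (o.init e) = ε * s (o.term e)) {x : X} (hx : s x = 0) : s = 0 := by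
  funext y
  have := o.sq_eq_of_signed hN hε hs y x
  rw [hx, mul_zero] at this
  exact mul_self_eq_zero.1 this

/-- The square of `s` is constant and nonzero, so `s` has only the values `±s x`; the sign is a
2-colouring. -/
theorem isBipartite_of_signed (hN : N.graph.Connected) {s : X → ℂ} (h0 : s ≠ 0)
    (hs : ∀ e, s (o.init e) = -1 * s (o.term e)) : N.graph.IsBipartite := by
  classical
  obtain ⟨x, hx⟩ := Function.ne_iff.1 h0
  have hne : ∀ y, s y ≠ 0 := fun y hy =>
    hx (congrFun (o.eq_zero_of_signed hN (by ring) hs hy) x)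
  have hadj : ∀ y y', N.graph.Adj y y' → s y = -s y' := by
    intro y y' h
    obtain ⟨e, ⟨rfl, rfl⟩ | ⟨rfl, rfl⟩⟩ := o.exists_edge h
    · rw [hs]; ring
    · rw [hs]; ring
  have : N.graph.Coloring Bool := SimpleGraph.Coloring.mk (fun y => decide (s y = s x)) (by
    intro y y' h h'
    have h1 := hadj y y' h
    have h2 : s y = s x ↔ s y' = s x := by simpa using h'
    have h3 := mul_self_eq_mul_self_iff.1 (o.sq_eq_of_signed hN (by ring) hs y x)
    have hy : s y = s y' := by
      rcases h3 with h3 | h3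
      · rw [h3, h2.1 h3]
      · have h4 : s y' = s x := by linear_combination h1 - h3
        rw [h2.2 h4, h4]
    refine hne y' ?_
    have h5 : (2 : ℂ) * s y' = 0 := by linear_combination h1 - hy
    simpa using h5)
  simpa using this.colorable

variable [Fintype X] [DecidableEq X]

/-- The weighted incidence matrix, with sign `-ε` at the terminal vertices. -/
noncomputable def incidence (ε : ℂ) : Matrix X N.Edge ℂ :=
  Matrix.of fun x e =>
    o.weight e * ((if o.init e = x then 1 else 0) + (if o.term e = x then -ε else 0))

theorem incidence_mulVec (ε : ℂ) (t : N.Edge → ℂ) (x : X) :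
    (o.incidence ε).mulVec t x = o.boundarySum t (fun e => -ε * t e) x := by
  rw [Matrix.mulVec, dotProduct, boundarySum]
  refine Finset.sum_congr rfl fun e _ => ?_
  rw [incidence, Matrix.of_apply]
  split_ifs <;> ring

theorem sum_mul_incidence_mulVec (ε : ℂ) (s : X → ℂ) (t : N.Edge → ℂ) :
    ∑ x, s x * (o.incidence ε).mulVec t x =
      ∑ e, o.weight e * ((s (o.init e) - ε * s (o.term e)) * t e) := by
  simp only [incidence_mulVec]
  rw [sum_mul_boundarySum]
  exact Finset.sum_congr rfl fun e _ => by ring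

theorem incidence_transpose_mulVec (ε : ℂ) (s : X → ℂ) (e : N.Edge) :
    (o.incidence ε).transpose.mulVec s e =
      o.weight e * (s (o.init e) - ε * s (o.term e)) := by
  rw [Matrix.mulVec, dotProduct]
  simp only [Matrix.transpose_apply, incidence, Matrix.of_apply, mul_add, add_mul, mul_ite,
    mul_one, mul_zero, ite_mul, zero_mul, Finset.sum_add_distrib, Finset.sum_ite_eq,
    Finset.mem_univ, if_true]
  ring

/-- The left kernel consists of functions scaled by `ε` along edges. It measures how far the
incidence matrix is from being surjective. -/
theorem mem_ker_incidence_transpose {ε : ℂ} {s : X → ℂ} :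
    s ∈ LinearMap.ker (o.incidence ε).transpose.mulVecLin ↔
      ∀ e, s (o.init e) = ε * s (o.term e) := by
  rw [LinearMap.mem_ker, Matrix.mulVecLin_apply, funext_iff]
  refine forall_congr' fun e => ?_
  rw [incidence_transpose_mulVec, Pi.zero_apply, mul_eq_zero, or_iff_right (o.weight_ne_zero e),
    sub_eq_zero]

theorem exists_incidence_ker_of_card_lt (ε : ℂ) (h : Fintype.card X < Fintype.card N.Edge) :
    ∃ t : N.Edge → ℂ, t ≠ 0 ∧ (o.incidence ε).mulVec t = 0 := by
  have hker : LinearMap.ker (o.incidence ε).mulVecLin ≠ ⊥ :=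
    LinearMap.ker_ne_bot_of_finrank_lt (by
      rwa [Module.finrank_fintype_fun_eq_card, Module.finrank_fintype_fun_eq_card])
  obtain ⟨t, ht, h0⟩ := Submodule.exists_mem_ne_zero_of_ne_bot hker
  exact ⟨t, h0, ht⟩

/-- A nonzero element of the left kernel rules out surjectivity. With at least as many edges as
vertices, injectivity would force surjectivity. -/
theorem exists_incidence_ker_of_card_le {ε : ℂ} (h : Fintype.card X ≤ Fintype.card N.Edge)
    {s : X → ℂ} (hs0 : s ≠ 0) (hs : ∀ e, s (o.init e) = ε * s (o.term e)) :
    ∃ t : N.Edge → ℂ, t ≠ 0 ∧ (o.incidence ε).mulVec t = 0 := by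
  by_contra hcon
  push Not at hcon
  have hinj : Function.Injective (o.incidence ε).mulVecLin := by
    rw [← LinearMap.ker_eq_bot, LinearMap.ker_eq_bot']
    intro t ht
    by_contra h0
    exact hcon t h0 ht
  have hsurj : Function.Surjective (o.incidence ε).mulVecLin := by
    rw [← LinearMap.range_eq_top]
    refine Submodule.eq_top_of_finrank_eq (le_antisymm (Submodule.finrank_le _) ?_)
    rw [LinearMap.finrank_range_of_inj hinj, Module.finrank_fintype_fun_eq_card,
      Module.finrank_fintype_fun_eq_card]
    exact h
  refine hs0 (funext fun x => ?_)
  obtain ⟨t, ht⟩ := hsurj (Pi.single x 1)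
  have h1 := o.sum_mul_incidence_mulVec ε s t
  rw [← Matrix.mulVecLin_apply, ht] at h1
  simp only [hs, sub_self, zero_mul, mul_zero, Finset.sum_const_zero] at h1
  simpa [Pi.single_apply] using h1

/-- Equality of row and column rank gives `dim ker A = |E| - |X| + dim ker Aᵀ`. -/
theorem incidence_ker_eq_zero {ε : ℂ}
    (h : Fintype.card N.Edge +
      Module.finrank ℂ (LinearMap.ker (o.incidence ε).transpose.mulVecLin) ≤ Fintype.card X)
    {t : N.Edge → ℂ} (ht : (o.incidence ε).mulVec t = 0) : t = 0 := by
  have h1 := (o.incidence ε).mulVecLin.finrank_range_add_finrank_ker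
  have h2 := (o.incidence ε).transpose.mulVecLin.finrank_range_add_finrank_ker
  have h3 := (o.incidence ε).rank_transpose
  rw [Matrix.rank, Matrix.rank] at h3
  rw [Module.finrank_fintype_fun_eq_card] at h1 h2
  have h4 : Module.finrank ℂ (LinearMap.ker (o.incidence ε).mulVecLin) = 0 := by omega
  have h5 := Submodule.finrank_eq_zero.1 h4
  exact LinearMap.ker_eq_bot'.1 h5 t ht

/-- The left kernel has dimension at most one, since its members are determined by one value, and a
tree has `|X| - 1` edges. -/
theorem incidence_ker_eq_zero_of_isTree (hN : N.graph.IsTree) {ε : ℂ} (hε : ε * ε = 1)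
    {t : N.Edge → ℂ} (ht : (o.incidence ε).mulVec t = 0) : t = 0 := by
  refine o.incidence_ker_eq_zero ?_ ht
  have hcard := (SimpleGraph.isTree_iff_connected_and_card.1 hN).2
  rw [show Nat.card N.graph.edgeSet = Fintype.card N.Edge from Nat.card_eq_fintype_card,
    Nat.card_eq_fintype_card] at hcard
  obtain ⟨x⟩ := hN.connected.nonempty
  have h1 : Module.finrank ℂ (LinearMap.ker (o.incidence ε).transpose.mulVecLin) ≤ 1 := by
    have := LinearMap.finrank_le_finrank_of_injective
      (f := (LinearMap.proj x : (X → ℂ) →ₗ[ℂ] ℂ).comp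
        (LinearMap.ker (o.incidence ε).transpose.mulVecLin).subtype) (by
        rw [← LinearMap.ker_eq_bot, LinearMap.ker_eq_bot']
        rintro ⟨s, hs⟩ h
        exact Subtype.ext (o.eq_zero_of_signed hN.connected hε
          (o.mem_ker_incidence_transpose.1 hs) h))
    simpa using this
  omega

theorem incidence_ker_eq_zero_of_not_isBipartite (hN : N.graph.Connected)
    (hb : ¬ N.graph.IsBipartite) (hcard : Fintype.card N.Edge ≤ Fintype.card X)
    {t : N.Edge → ℂ} (ht : (o.incidence (-1)).mulVec t = 0) : t = 0 := by
  refine o.incidence_ker_eq_zero ?_ ht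
  have h1 : LinearMap.ker (o.incidence (-1)).transpose.mulVecLin = ⊥ := by
    rw [Submodule.eq_bot_iff]
    intro s hs
    by_contra h0
    exact hb (o.isBipartite_of_signed hN h0 (o.mem_ker_incidence_transpose.1 hs))
  rw [h1, finrank_bot]
  exact hcard

end Network.Orientation

end IncidenceKernel

/-! ### Which eigenvalues of `Q_{V^o}` survive in `X[V]` -/

section InteriorEigenvalues

variable {X V : Type*} [Fintype X] [DecidableEq X] [Fintype V] [DecidableEq V]
  {N : Network X} {M : Network V} (o : N.Orientation) {a b : V} {z : ℂ}

/-- Placing `t e • f` on the copy `e` turns the balance of fluxes into the kernel equation of the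
incidence matrix. -/
theorem IsFluxLine.mem_spec_subst (hab : a ≠ b) (γ : M.Swap a b) (hN : ∀ x, 0 < N.total x)
    (hM : ∀ v, 0 < M.total v) {ε : ℂ} (hz : IsFluxLine M.transition a b z ε)
    (ht : ∃ t : N.Edge → ℂ, t ≠ 0 ∧ (o.incidence ε).mulVec t = 0) :
    z ∈ spec (N.subst M a b o).transition := by
  obtain ⟨f, hf, ha, hb, -⟩ := hz
  obtain ⟨t, ht0, ht⟩ := ht
  refine mem_spec_subst_of_interior o hab γ hN hM (fun e => t e • f)
    (fun e => Submodule.smul_mem _ _ hf) (fun x => ?_) fun h => ht0 (funext fun e => ?_)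
  · have := congrFun ht x
    rw [o.incidence_mulVec, Pi.zero_apply] at this
    rw [← this]
    congr 1
    · funext e
      rw [interiorFlux_smul, ha, mul_one]
    · funext e
      rw [interiorFlux_smul, hb, mul_comm]
  · have h1 := congrArg (fun u => interiorFlux M.transition u a) (congrFun h e)
    simpa [interiorFlux_smul, interiorFlux_zero, ha] using h1

/-- Both fluxes can be prescribed freely on each edge: `2|E|` unknowns against `|X|` balance
equations. -/
theorem IsFluxPlane.mem_spec_subst (hab : a ≠ b) (γ : M.Swap a b) (hN : ∀ x, 0 < N.total x)
    (hM : ∀ v, 0 < M.total v) (hz : IsFluxPlane M.transition a b z)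
    (hcard : Fintype.card X < 2 * Fintype.card N.Edge) :
    z ∈ spec (N.subst M a b o).transition := by
  obtain ⟨f, hf, g, hg, ⟨hfa, hfb⟩, ⟨hga, hgb⟩, -⟩ := hz
  let L : ((N.Edge → ℂ) × (N.Edge → ℂ)) →ₗ[ℂ] (X → ℂ) :=
    { toFun := fun p => o.boundarySum p.1 p.2
      map_add' := fun p q => funext fun x => (o.boundarySum_add ..).symm
      map_smul' := fun c p => funext fun x => (o.mul_boundarySum ..).symm }
  have hker : LinearMap.ker L ≠ ⊥ := LinearMap.ker_ne_bot_of_finrank_lt (by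
    rw [Module.finrank_prod, Module.finrank_fintype_fun_eq_card,
      Module.finrank_fintype_fun_eq_card]
    omega)
  obtain ⟨⟨t, u⟩, htu, h0⟩ := Submodule.exists_mem_ne_zero_of_ne_bot hker
  have hΦa : ∀ e, interiorFlux M.transition (t e • f + u e • g) a = t e := fun e => by
    rw [interiorFlux_add, interiorFlux_smul, interiorFlux_smul, hfa, hga]; ring
  have hΦb : ∀ e, interiorFlux M.transition (t e • f + u e • g) b = u e := fun e => by
    rw [interiorFlux_add, interiorFlux_smul, interiorFlux_smul, hfb, hgb]; ring
  refine mem_spec_subst_of_interior o hab γ hN hM (fun e => t e • f + u e • g)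
    (fun e => Submodule.add_mem _ (Submodule.smul_mem _ _ hf) (Submodule.smul_mem _ _ hg))
    (fun x => ?_) fun h => h0 ?_
  · simp only [hΦa, hΦb]
    exact congrFun htu x
  · have h1 : ∀ e, t e • f + u e • g = 0 := fun e => congrFun h e
    refine Prod.ext (funext fun e => ?_) (funext fun e => ?_)
    · change t e = 0
      rw [← hΦa e, h1, interiorFlux_zero]
    · change u e = 0
      rw [← hΦb e, h1, interiorFlux_zero]

theorem flux_injective_of_notMem_spec_subst [Nonempty N.Edge] (hab : a ≠ b) (γ : M.Swap a b)
    (hN : ∀ x, 0 < N.total x) (hM : ∀ v, 0 < M.total v)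
    (hz : z ∉ spec (N.subst M a b o).transition) {f : Interior a b → ℂ}
    (hf : f ∈ eigenspaceOf (interiorPart M.transition a b) z)
    (ha : interiorFlux M.transition f a = 0) (hb : interiorFlux M.transition f b = 0) :
    f = 0 := by
  by_contra h0
  refine hz (mem_spec_subst_of_interior o hab γ hN hM (fun _ => f) (fun _ => hf)
    (fun x => ?_) fun h => h0 ?_)
  · simp [Network.Orientation.boundarySum, ha, hb]
  · obtain ⟨e⟩ := ‹Nonempty N.Edge›
    exact congrFun h e

/-- An eigenfunction over `X[V]` which does not vanish on `X` and is multiplied by `ε` along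
each edge is carried over to an eigenfunction of `V`. -/
theorem mem_spec_of_signed_eigenfunction [Nonempty N.Edge] (hX : N.graph.Connected)
    (hab : a ≠ b) (γ : M.Swap a b) (hN : ∀ x, 0 < N.total x) (hM : ∀ v, 0 < M.total v)
    {ε : ℂ} (hε : ε * ε = 1) {f : X ⊕ (N.Edge × Interior a b) → ℂ}
    (hf : (N.subst M a b o).transition.mulVec f = z • f)
    (hs : ∀ e, f (Sum.inl (o.init e)) = ε * f (Sum.inl (o.term e))) {x : X}
    (hx : f (Sum.inl x) ≠ 0) : z ∈ spec M.transition := by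
  obtain ⟨h1, h2⟩ := (subst_mulVec_eq_smul_iff o hab γ hN hM f z).1 hf
  set s : X → ℂ := fun x => f (Sum.inl x) with hsdef
  set g : N.Edge → V → ℂ := fun e v => f (identify o a b e v) with hgdef
  have hs' : ∀ e, s (o.term e) = ε * s (o.init e) := fun e => by
    have := hs e
    change s _ = ε * s _ at this
    linear_combination (-ε) * this - s (o.term e) * hε
  have hga : ∀ e, g e a = s (o.init e) := fun e => by simp [hgdef, hsdef]
  have hgb : ∀ e, g e b = s (o.term e) := fun e => by simp [hgdef, hsdef, identify_right o hab]
  -- The weight `s(e^a)` makes `G a` the total edge weight times the constant square of `s`, hence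
  -- nonzero.
  set G : V → ℂ := ∑ e, ((o.weight e : ℂ) * s (o.init e)) • g e with hG
  have hGint : InteriorEigen M.transition a b z G := InteriorEigen.sum _ _ fun e _ => h1 e
  have hQG : ∀ v, M.transition.mulVec G v =
      ∑ e, (o.weight e : ℂ) * s (o.init e) * M.transition.mulVec (g e) v := fun v => by
    rw [hG, Matrix.mulVec_sum, Finset.sum_apply]
    exact Finset.sum_congr rfl fun e _ => by rw [Matrix.mulVec_smul]; rfl
  have hGv : ∀ v, G v = ∑ e, (o.weight e : ℂ) * s (o.init e) * g e v := fun v => by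
    rw [hG, Finset.sum_apply]
    rfl
  have hGb : G b = ε * G a := by
    rw [hGv, hGv, Finset.mul_sum]
    refine Finset.sum_congr rfl fun e _ => ?_
    rw [hga, hgb, hs']
    ring
  have hGa : G a ≠ 0 := by
    have : G a = ((∑ e, o.weight e : ℝ) : ℂ) * (s x * s x) := by
      rw [hGv, Complex.ofReal_sum, Finset.sum_mul]
      refine Finset.sum_congr rfl fun e _ => ?_
      rw [hga, mul_assoc, o.sq_eq_of_signed hX hε hs _ x]
    rw [this]
    have hw : 0 < ∑ e, o.weight e :=
      Finset.sum_pos (fun e _ => o.weight_pos e) Finset.univ_nonempty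
    exact mul_ne_zero (by exact_mod_cast hw.ne') (mul_ne_zero hx hx)
  -- Pairing the balance equations with `s` gives only one combination of the equations at `a` and
  -- `b`. The symmetrization `H` below turns it into both.
  have hkey : M.transition.mulVec G a + ε * M.transition.mulVec G b = z * (2 * G a) := by
    have hl : M.transition.mulVec G a + ε * M.transition.mulVec G b =
        ∑ x, s x * o.boundarySum (fun e => M.transition.mulVec (g e) a)
          (fun e => M.transition.mulVec (g e) b) x := by
      rw [o.sum_mul_boundarySum, hQG, hQG, Finset.mul_sum, ← Finset.sum_add_distrib]
      refine Finset.sum_congr rfl fun e _ => ?_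
      rw [hs']
      ring
    have hr : 2 * G a = ∑ x, s x * o.boundarySum (fun e => s (o.init e) * 1)
        (fun e => s (o.term e) * 1) x := by
      rw [o.sum_mul_boundarySum, hGv, Finset.mul_sum]
      refine Finset.sum_congr rfl fun e _ => ?_
      rw [hga, hs']
      linear_combination (-(o.weight e : ℂ) * s (o.init e) * s (o.init e)) * hε
    rw [hl, hr, Finset.mul_sum]
    refine Finset.sum_congr rfl fun x _ => ?_
    rw [h2, o.boundarySum_mul_endpoint, o.boundarySum_one]
    ring
  set H : V → ℂ := G + ε • fun v => G (γ.perm v) with hH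
  have hQH : ∀ v, M.transition.mulVec H v =
      M.transition.mulVec G v + ε * M.transition.mulVec G (γ.perm v) := fun v => by
    rw [hH, Matrix.mulVec_add, Matrix.mulVec_smul, Pi.add_apply, Pi.smul_apply, γ.mulVec_comp]
    rfl
  have hHv : ∀ v, H v = G v + ε * G (γ.perm v) := fun v => rfl
  have hHa : H a = 2 * G a := by
    rw [hHv, γ.map_a, hGb]
    linear_combination G a * hε
  have hHb : H b = ε * (2 * G a) := by
    rw [hHv, γ.map_b, hGb]
    ring
  refine mem_spec_iff.2 ⟨H, fun h => hGa ?_, ?_⟩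
  · rw [h, Pi.zero_apply] at hHa
    simpa using hHa.symm
  · refine (mulVec_eq_smul_iff (a := a) (b := b)).2
      ⟨hGint.add_smul ε (hGint.comp_swap γ), ?_, ?_⟩
    · rw [hQH, γ.map_a, hkey, hHa]
    · rw [hQH, γ.map_b, hHb]
      linear_combination ε * hkey - M.transition.mulVec G b * hε

/-- Boundary orthogonality forces the sign rule on `s`. If `s = 0`, every copy carries a multiple of
`f₀` and the trivial incidence kernel kills it; otherwise averaging yields an eigenfunction of `Q`.
-/
theorem IsFluxLine.exists_signed_of_mem_spec_subst [Nonempty N.Edge] (hX : N.graph.Connected)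
    (hab : a ≠ b) (γ : M.Swap a b) (hN : ∀ x, 0 < N.total x) (hM : ∀ v, 0 < M.total v)
    {ε : ℂ} (hε : ε * ε = 1) (hz : IsFluxLine M.transition a b z ε)
    (ht : ∀ t : N.Edge → ℂ, (o.incidence ε).mulVec t = 0 → t = 0)
    (hmem : z ∈ spec (N.subst M a b o).transition) :
    z ∈ spec M.transition ∧
      ∃ s : X → ℂ, s ≠ 0 ∧ ∀ e, s (o.init e) = ε * s (o.term e) := by
  obtain ⟨f₀, hf₀, hfa, hfb, hspan⟩ := hz
  obtain ⟨f, hf0, hf⟩ := mem_spec_iff.1 hmem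
  obtain ⟨h1, h2⟩ := (subst_mulVec_eq_smul_iff o hab γ hN hM f z).1 hf
  have hga : ∀ e, f (identify o a b e a) = f (Sum.inl (o.init e)) := fun e => by simp
  have hgb : ∀ e, f (identify o a b e b) = f (Sum.inl (o.term e)) := fun e => by
    rw [identify_right o hab]
  have hs : ∀ e, f (Sum.inl (o.init e)) = ε * f (Sum.inl (o.term e)) := fun e => by
    have := (h1 e).boundary_orthogonal hab (fun v => (hM v).ne') γ hf₀
    rw [hfa, hfb, hga, hgb] at this
    linear_combination this
  by_cases h0 : ∀ x, f (Sum.inl x) = 0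
  · exfalso
    have hmem : ∀ e, (fun v : Interior a b => f (identify o a b e v)) ∈
        eigenspaceOf (interiorPart M.transition a b) z := fun e =>
      (h1 e).restrict_mem hab (by rw [hga, h0]) (by rw [hgb, h0])
    choose t htf using fun e => hspan _ (hmem e)
    have hQ : ∀ e w, M.transition.mulVec (fun v => f (identify o a b e v)) w =
        t e * interiorFlux M.transition f₀ w := fun e w => by
      rw [← interiorFlux_restrict hab _ (g := fun v => f (identify o a b e v))
        (by rw [hga, h0]) (by rw [hgb, h0]), htf e, interiorFlux_smul]
    have ht0 : t = 0 := ht t (funext fun x => by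
      have := h2 x
      simp only [hQ, hfa, hfb, mul_one, h0, mul_zero] at this
      rw [o.incidence_mulVec, Pi.zero_apply, ← this]
      congr 1
      funext e
      ring)
    refine hf0 (funext fun p => ?_)
    rcases p with x | ⟨e, v⟩
    · exact h0 x
    · have := congrFun (htf e) v
      rw [ht0] at this
      simpa using this
  · push Not at h0
    obtain ⟨x, hx⟩ := h0
    exact ⟨mem_spec_of_signed_eigenfunction o hX hab γ hN hM hε hf hs hx,
      fun x => f (Sum.inl x), fun h => hx (congrFun h x), hs⟩

/-- Orthogonality to `(1,0)` and `(0,1)` kills the values on `X`. With a single edge no other copy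
can compensate a flux, so both fluxes vanish. -/
theorem IsFluxPlane.notMem_spec_subst (hab : a ≠ b) (γ : M.Swap a b)
    (hN : ∀ x, 0 < N.total x) (hM : ∀ v, 0 < M.total v) (hz : IsFluxPlane M.transition a b z)
    [Subsingleton N.Edge] (hcov : ∀ x, ∃ e, o.init e = x ∨ o.term e = x) :
    z ∉ spec (N.subst M a b o).transition := by
  intro hmem
  obtain ⟨f₀, hf₀, g₀, hg₀, ⟨hfa, hfb⟩, ⟨hga, hgb⟩, hspan⟩ := hz
  obtain ⟨f, hf0, hf⟩ := mem_spec_iff.1 hmem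
  obtain ⟨h1, h2⟩ := (subst_mulVec_eq_smul_iff o hab γ hN hM f z).1 hf
  have hia : ∀ e, f (identify o a b e a) = f (Sum.inl (o.init e)) := fun e => by simp
  have hib : ∀ e, f (identify o a b e b) = f (Sum.inl (o.term e)) := fun e => by
    rw [identify_right o hab]
  have h0 : ∀ x, f (Sum.inl x) = 0 := by
    intro x
    obtain ⟨e, rfl | rfl⟩ := hcov x
    · have := (h1 e).boundary_orthogonal hab (fun v => (hM v).ne') γ hf₀
      rw [hfa, hfb, hia] at this
      simpa using this
    · have := (h1 e).boundary_orthogonal hab (fun v => (hM v).ne') γ hg₀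
      rw [hga, hgb, hib] at this
      simpa using this
  refine hf0 (eq_zero_of_comp_identify_eq_zero o (a := a) (b := b) h0 fun e v => ?_)
  have huniv : (Finset.univ : Finset N.Edge) = {e} := Finset.eq_singleton_iff_unique_mem.2
    ⟨Finset.mem_univ _, fun e' _ => Subsingleton.elim _ _⟩
  have hne := o.init_ne_term e
  have hQa : M.transition.mulVec (fun v => f (identify o a b e v)) a = 0 := by
    have := h2 (o.init e)
    rw [Network.Orientation.boundarySum, huniv, Finset.sum_singleton, if_pos rfl,
      if_neg hne.symm, h0, add_zero, mul_zero, mul_zero] at this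
    exact (mul_eq_zero.1 this).resolve_left (o.weight_ne_zero e)
  have hQb : M.transition.mulVec (fun v => f (identify o a b e v)) b = 0 := by
    have := h2 (o.term e)
    rw [Network.Orientation.boundarySum, huniv, Finset.sum_singleton, if_pos rfl,
      if_neg hne, h0, zero_add, mul_zero, mul_zero] at this
    exact (mul_eq_zero.1 this).resolve_left (o.weight_ne_zero e)
  have hr := interiorFlux_restrict hab M.transition (g := fun v => f (identify o a b e v))
    (by rw [hia, h0]) (by rw [hib, h0])
  obtain ⟨c, d, hcd⟩ := hspan _ ((h1 e).restrict_mem hab (by rw [hia, h0]) (by rw [hib, h0]))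
  rw [hcd] at hr
  have hc := (hr a).trans hQa
  have hd := (hr b).trans hQb
  rw [interiorFlux_add, interiorFlux_smul, interiorFlux_smul, hfa, hga] at hc
  rw [interiorFlux_add, interiorFlux_smul, interiorFlux_smul, hfb, hgb] at hd
  have hc0 : c = 0 := by linear_combination hc
  have hd0 : d = 0 := by linear_combination hd
  by_cases hva : v = a
  · rw [hva, hia, h0]
  by_cases hvb : v = b
  · rw [hvb, hib, h0]
  have := congrFun hcd ⟨v, hva, hvb⟩
  rw [hc0, hd0] at this
  simpa using this

end InteriorEigenvalues

/-! ### The exceptional set -/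

section ExceptionalSet

variable {X V : Type*} [Fintype X] [DecidableEq X] [Fintype V] [DecidableEq V]
  {N : Network X} {M : Network V} (o : N.Orientation) {a b : V} {z : ℂ}

/-- The cardinality condition serves to exclude type IV°; among connected graphs with at least two
vertices it fails only for a single edge. -/
theorem types_of_notMem_spec_subst [Nonempty N.Edge] (hab : a ≠ b) (γ : M.Swap a b)
    (hN : ∀ x, 0 < N.total x) (hM : ∀ v, 0 < M.total v)
    (hcard : Fintype.card X < 2 * Fintype.card N.Edge)
    (hz : z ∈ spec (interiorPart M.transition a b))
    (hz' : z ∉ spec (N.subst M a b o).transition) :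
    mult (interiorPart M.transition a b) z = 1 ∧ (HasTypeIIo M γ z ∨ HasTypeIIIo M γ z) := by
  rcases types_of_flux_injective hab γ hz
    fun f hf => flux_injective_of_notMem_spec_subst o hab γ hN hM hz' hf with h | h | ⟨hm, h⟩
  · exact ⟨h.1, Or.inl h.2⟩
  · exact ⟨h.1, Or.inr h.2⟩
  · exact absurd ((isFluxPlane_of_hasTypeIVo γ hm h).mem_spec_subst o hab γ hN hM hcard) hz'

theorem notMem_spec_subst_of_isTree [Nonempty N.Edge] (hX : N.graph.IsTree) (hab : a ≠ b)
    (γ : M.Swap a b) (hN : ∀ x, 0 < N.total x) (hM : ∀ v, 0 < M.total v)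
    (hz : z ∉ spec M.transition) (hm : mult (interiorPart M.transition a b) z = 1)
    (ht : HasTypeIIo M γ z ∨ HasTypeIIIo M γ z) :
    z ∉ spec (N.subst M a b o).transition := by
  have key : ∀ ε : ℂ, ε * ε = 1 → IsFluxLine M.transition a b z ε →
      z ∉ spec (N.subst M a b o).transition := fun ε hε h hmem =>
    hz (h.exists_signed_of_mem_spec_subst o hX.connected hab γ hN hM hε
      (fun t => o.incidence_ker_eq_zero_of_isTree hX hε) hmem).1
  rcases ht with h | h
  · exact key (-1) (by ring) (isFluxLine_of_hasTypeIIo γ hm h)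
  · exact key 1 (by ring) (isFluxLine_of_hasTypeIIIo γ hm h)

/-- Type (III°) eigenvalues occur over `X[V]` when `X` is not a tree. -/
theorem mem_spec_subst_of_hasTypeIIIo [Nonempty X] (hab : a ≠ b) (γ : M.Swap a b)
    (hN : ∀ x, 0 < N.total x) (hM : ∀ v, 0 < M.total v)
    (hcard : Fintype.card X ≤ Fintype.card N.Edge)
    (hm : mult (interiorPart M.transition a b) z = 1) (h : HasTypeIIIo M γ z) :
    z ∈ spec (N.subst M a b o).transition :=
  (isFluxLine_of_hasTypeIIIo γ hm h).mem_spec_subst o hab γ hN hM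
    (o.exists_incidence_ker_of_card_le hcard (s := fun _ => 1)
      (fun h => one_ne_zero (congrFun h (Classical.arbitrary X))) fun _ => by ring)

/-- Type (II°) eigenvalues occur over `X[V]` when `X` is neither a tree nor a graph with a
unique cycle of odd length. -/
theorem mem_spec_subst_of_hasTypeIIo (hX : N.graph.Connected) (hab : a ≠ b) (γ : M.Swap a b)
    (hN : ∀ x, 0 < N.total x) (hM : ∀ v, 0 < M.total v)
    (hcard : Fintype.card X ≤ Fintype.card N.Edge) (hodd : ¬ HasUniqueCycleOdd N.graph)
    (hm : mult (interiorPart M.transition a b) z = 1) (h : HasTypeIIo M γ z) :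
    z ∈ spec (N.subst M a b o).transition := by
  refine (isFluxLine_of_hasTypeIIo γ hm h).mem_spec_subst o hab γ hN hM ?_
  by_cases hb : N.graph.IsBipartite
  · obtain ⟨χ⟩ := hb
    obtain ⟨x⟩ := hX.nonempty
    refine o.exists_incidence_ker_of_card_le hcard (s := fun x => if χ x = 0 then 1 else -1)
      (fun h => ?_) fun e => ?_
    · have := congrFun h x
      simp only [Pi.zero_apply] at this
      split_ifs at this <;> simp at this
    · have := χ.valid (o.adj e)
      generalize χ (o.init e) = i at *
      generalize χ (o.term e) = j at *
      fin_cases i <;> fin_cases j <;> simp_all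
  · refine o.exists_incidence_ker_of_card_lt _ (lt_of_not_ge fun hle => hodd ?_)
    refine hX.hasUniqueCycleOdd_of_card_le ?_ hb
    rw [show Nat.card N.graph.edgeSet = Fintype.card N.Edge from Nat.card_eq_fintype_card,
      Nat.card_eq_fintype_card]
    exact hle

end ExceptionalSet

theorem mainTheorem1 {X V : Type*} [Fintype X] [DecidableEq X] [Nontrivial X]
    [Fintype V] [DecidableEq V]
    (NX : Network X) (hX : NX.graph.Connected)
    (NV : Network V) (hV : NV.graph.Connected)
    (a b : V) (hab : a ≠ b) (γ : NV.Swap a b)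
    (hVb : (NV.graph.induce {v | v ≠ b}).Connected)
    (o : NX.Orientation) :
    (∃ Exc : Set ℂ,
      spec (NX.subst NV a b o).transition =
        (S1 NX.transition NV.transition a b ∪ S2 NV.transition a b ∪
          spec (interiorPart NV.transition a b)) \ Exc ∧
      (¬ NX.graph.IsTree → ¬ HasUniqueCycleOdd NX.graph → Exc = ∅) ∧
      (NX.graph.IsTree → 3 ≤ Fintype.card X →
        Exc = {z | z ∈ spec (interiorPart NV.transition a b) \ spec NV.transition ∧
          mult (interiorPart NV.transition a b) z = 1 ∧
          (HasTypeIIo NV γ z ∨ HasTypeIIIo NV γ z)}) ∧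
      (NX.graph.IsTree → Fintype.card X = 2 →
        Exc = {z | z ∈ spec (interiorPart NV.transition a b) \ spec NV.transition ∧
            mult (interiorPart NV.transition a b) z = 1 ∧
            (HasTypeIIo NV γ z ∨ HasTypeIIIo NV γ z)} ∪
          {z | z ∈ spec (interiorPart NV.transition a b) \ spec NV.transition ∧
            mult (interiorPart NV.transition a b) z = 2 ∧ HasTypeIVo NV γ z}) ∧
      (HasUniqueCycleOdd NX.graph →
        Exc = {z | z ∈ spec (interiorPart NV.transition a b) \ spec NV.transition ∧
            mult (interiorPart NV.transition a b) z = 1 ∧ HasTypeIIo NV γ z} ∪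
          {z | z ∈ spec (interiorPart NV.transition a b) ∩ spec NV.transition ∧
            mult (interiorPart NV.transition a b) z = 1 ∧ mult NV.transition z = 1 ∧
            HasTypeIIo NV γ z ∧ HasTypeIII NV γ z})) ∧
    (NX.graph.IsBipartite →
      spec NV.transition ⊆ spec (NX.subst NV a b o).transition) ∧
    (¬ NX.graph.IsBipartite →
      spec NV.transition \
          {z | z ∈ spec NV.transition ∧ HasTypeIII NV γ z ∧ mult NV.transition z = 1} ⊆
        spec (NX.subst NV a b o).transition) := by
  have : Nontrivial V := ⟨a, b, hab⟩
  have hN : ∀ x, 0 < NX.total x := Network.total_pos hX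
  have hM : ∀ v, 0 < NV.total v := Network.total_pos hV
  have hcov : ∀ x, ∃ e, o.init e = x ∨ o.term e = x := fun x => by
    obtain ⟨y, hy⟩ := hX.preconnected.exists_adj_of_nontrivial x
    obtain ⟨e, h | h⟩ := o.exists_edge hy
    · exact ⟨e, Or.inl h.1⟩
    · exact ⟨e, Or.inr h.2⟩
  obtain ⟨x₀⟩ := hX.nonempty
  have : Nonempty NX.Edge := ⟨(hcov x₀).choose⟩
  have hE : Nat.card NX.graph.edgeSet = Fintype.card NX.Edge := Nat.card_eq_fintype_card
  have hcard2 : 2 ≤ Fintype.card X := Fintype.one_lt_card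
  have htree : NX.graph.IsTree → Fintype.card NX.Edge + 1 = Fintype.card X := fun h => by
    have := (SimpleGraph.isTree_iff_connected_and_card.1 h).2
    rwa [hE, Nat.card_eq_fintype_card] at this
  have hntree : ¬ NX.graph.IsTree → Fintype.card X ≤ Fintype.card NX.Edge := fun h => by
    have h1 := hX.card_vert_le_card_edgeSet_add_one
    rw [hE, Nat.card_eq_fintype_card] at h1
    have h2 : Fintype.card NX.Edge + 1 ≠ Fintype.card X := fun h2 =>
      h (SimpleGraph.isTree_iff_connected_and_card.2
        ⟨hX, by rw [hE, h2, Nat.card_eq_fintype_card]⟩)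
    omega
  have hC1 : NX.graph.IsBipartite →
      spec NV.transition ⊆ spec (NX.subst NV a b o).transition :=
    spec_subset_spec_subst_of_isBipartite o hab γ hN hM
  -- `Exc` is taken to be the set of eigenvalues of `Q_{V^o}` missing from `P_*`; each case then
  -- identifies this set.
  refine ⟨⟨spec (interiorPart NV.transition a b) \ spec (NX.subst NV a b o).transition,
    ?_, fun hT hU => ?_, fun hT h3 => ?_, fun hT h2 => ?_, fun hU => ?_⟩, hC1, fun _ z hz => ?_⟩
  · ext z
    by_cases hz : z ∈ spec (interiorPart NV.transition a b)
    · simp [hz]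
    · rw [mem_spec_subst_iff_mem_S1_union_S2 o hab γ hN hM hz]
      simp [hz]
  · have hle := hntree hT
    refine Set.eq_empty_iff_forall_notMem.2 ?_
    rintro z ⟨hz, hz'⟩
    obtain ⟨hm, h | h⟩ := types_of_notMem_spec_subst o hab γ hN hM (by omega) hz hz'
    · exact hz' (mem_spec_subst_of_hasTypeIIo o hX hab γ hN hM hle hU hm h)
    · exact hz' (mem_spec_subst_of_hasTypeIIIo o hab γ hN hM hle hm h)
  -- For a tree with `|X| ≥ 3`, `|X| < 2(|X| - 1)`, so type IV° cannot be missing. Trees are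
  -- bipartite, so missing values lie outside `spec(Q)`.
  · have := htree hT
    ext z
    constructor
    · rintro ⟨hz, hz'⟩
      exact ⟨⟨hz, fun h => hz' (hC1 hT.isBipartite h)⟩,
        types_of_notMem_spec_subst o hab γ hN hM (by omega) hz hz'⟩
    · rintro ⟨⟨hz, hz'⟩, hm, h⟩
      exact ⟨hz, notMem_spec_subst_of_isTree o hT hab γ hN hM hz' hm h⟩
  · have hcard := htree hT
    ext z
    constructor
    · rintro ⟨hz, hz'⟩
      have hzQ : z ∉ spec NV.transition := fun h => hz' (hC1 hT.isBipartite h)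
      rcases types_of_flux_injective hab γ hz fun f hf =>
        flux_injective_of_notMem_spec_subst o hab γ hN hM hz' hf with h | h | h
      · exact Or.inl ⟨⟨hz, hzQ⟩, h.1, Or.inl h.2⟩
      · exact Or.inl ⟨⟨hz, hzQ⟩, h.1, Or.inr h.2⟩
      · exact Or.inr ⟨⟨hz, hzQ⟩, h⟩
    · rintro (⟨⟨hz, hz'⟩, hm, h⟩ | ⟨⟨hz, hz'⟩, hm, h⟩)
      · exact ⟨hz, notMem_spec_subst_of_isTree o hT hab γ hN hM hz' hm h⟩
      · have : Subsingleton NX.Edge := Fintype.card_le_one_iff_subsingleton.1 (by omega)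
        exact ⟨hz, (isFluxPlane_of_hasTypeIVo γ hm h).notMem_spec_subst o hab γ hN hM hcov⟩
  · have hcard : Fintype.card NX.Edge = Fintype.card X := by
      have := hU.card_edgeSet hX
      rwa [hE, Nat.card_eq_fintype_card] at this
    have hb := hU.not_isBipartite
    -- A surviving eigenvalue would give a nonzero `s` changing sign along every edge, contradicting
    -- the odd cycle. Membership in `spec(Q)` plays no role here, which is why `Exc` has its second
    -- part.
    have hnot : ∀ z, mult (interiorPart NV.transition a b) z = 1 → HasTypeIIo NV γ z →
        z ∉ spec (NX.subst NV a b o).transition := by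
      intro z hm h hmem
      obtain ⟨-, s, hs0, hs⟩ :=
        (isFluxLine_of_hasTypeIIo γ hm h).exists_signed_of_mem_spec_subst o hX hab γ hN hM
          (by ring) (fun t => o.incidence_ker_eq_zero_of_not_isBipartite hX hb hcard.le) hmem
      exact hb (o.isBipartite_of_signed hX hs0 hs)
    ext z
    constructor
    · rintro ⟨hz, hz'⟩
      obtain ⟨hm, h | h⟩ := types_of_notMem_spec_subst o hab γ hN hM (by omega) hz hz'
      · by_cases hzQ : z ∈ spec NV.transition
        · obtain ⟨h3, hm3⟩ := hasTypeIII_of_notMem_spec_subst o hab γ hN hM hzQ hz'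
          exact Or.inr ⟨⟨hz, hzQ⟩, hm, hm3, h, h3⟩
        · exact Or.inl ⟨⟨hz, hzQ⟩, hm, h⟩
      · exact absurd (mem_spec_subst_of_hasTypeIIIo o hab γ hN hM hcard.ge hm h) hz'
    · rintro (⟨⟨hz, -⟩, hm, h⟩ | ⟨⟨hz, -⟩, hm, -, h, -⟩)
      · exact ⟨hz, hnot z hm h⟩
      · exact ⟨hz, hnot z hm h⟩
  · by_contra hz'
    exact hz.2 ⟨hz.1, hasTypeIII_of_notMem_spec_subst o hab γ hN hM hz.1 hz'⟩
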